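/- Let $n\in\mathbb N$, let $\|\cdot\|$ be a norm on $\mathbb R^n$, and give the space $\mathcal L(\mathbb R^n)$ of linear maps of $\mathbb R^n$ the operator norm. Let $A:[0,\infty)\to\mathcal L(\mathbb R^n)$ have bounded variation on every compact interval, and suppose that $I-(A(t)-A(t^-))$ is invertible for every $t>0$ and that $I+(A(t^+)-A(t))$ is invertible for every $t\ge 0$. For a normed space $X$ and $G:[a,b]\times[a,b]\to X$, the Kurzweil integral $\int_a^b DG(\tau,t)$ is the element $\mathcal I\in X$ (if there is one) such that for every $\varepsilon>0$ there is a function $\delta:[a,b]\to(0,\infty)$ with $$\Big\|\sum_{j=1}^{m}\big[G(\tau_j,\alpha_j)-G(\tau_j,\alpha_{j-1})\big]-\mathcal I\Big\|<\varepsilon$$ for all $a=\alpha_0<\alpha_1<\dots<\alpha_m=b$ and $\tau_j\in[\alpha_{j-1},\alpha_j]$ with $[\alpha_{j-1},\alpha_j]\subset(\tau_j-\delta(\tau_j),\tau_j+\delta(\tau_j))$ for all $j$; moreover $\int_b^a=-\int_a^b$ and $\int_a^a=0$. Write $\int_a^b d[A(r)]\,y(r)$ for this integral with $G(\tau,t)=A(t)y(\tau)$,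 where $y$ has values in $\mathbb R^n$ or in $\mathcal L(\mathbb R^n)$. Consider the homogeneous generalized linear differential equation (GLDE) $$\frac{dx}{d\tau}=D[A(t)x].$$ A function $x:J\to\mathbb R^n$ on an interval $J\subset[0,\infty)$ is a solution of it on $J$ if, for all $[c,d]\subset J$, the integral $\int_c^d d[A(r)]\,x(r)$ exists and equals $x(d)-x(c)$. Its transition matrix is the uniquely determined function $U:[0,\infty)\times[0,\infty)\to\mathcal L(\mathbb R^n)$ with $$U(t,s)=I+\int_s^t d[A(r)]\,U(r,s)\qquad\text{for all } t,s\ge 0.$$ The trivial solution is called stable if for every $s_0\ge0$ and every $\varepsilon>0$ there is $\delta>0$ such that, whenever $x_0\in\mathbb R^n$, $\|x_0\|<\delta$, and $x$ is the solution on $[s_0,\infty)$ with $x(s_0)=x_0$, then $\|x(t)\|<\varepsilon$ for all $t\ge s_0$. Then the trivial solution of the homogeneous GLDE is stable if and only if for every $s_0\ge 0$ there is a constant $C=C(s_0)>0$ such that $\|U(t,s_0)\|\le C$ for all $t\ge s_0$. -/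

import Mathlib

open Set

namespace GLDE

section KurzweilIntegral

variable {X : Type*} [NormedAddCommGroup X]

/-- `α 0 = a < α 1 < ... < α n = b` is a partition of `[a, b]` and `τ j` is a tag of its
`j`-th interval `[α j, α (j + 1)]`, for `j < n`. -/
structure IsTaggedPartition (a b : ℝ) (n : ℕ) (α τ : ℕ → ℝ) : Prop where
  left_eq : α 0 = a
  right_eq : α n = b
  lt_succ : ∀ j < n, α j < α (j + 1)
  tag_mem : ∀ j < n, τ j ∈ Icc (α j) (α (j + 1))

/-- A gauge on `[a, b]` is a function that is positive there. -/
def IsGauge (a b : ℝ) (δ : ℝ → ℝ) : Prop :=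
  ∀ t ∈ Icc a b, 0 < δ t

/-- The tagged partition given by `n`, `α`, `τ` is `δ`-fine. -/
def IsFine (δ : ℝ → ℝ) (n : ℕ) (α τ : ℕ → ℝ) : Prop :=
  ∀ j < n, Icc (α j) (α (j + 1)) ⊆ Ioo (τ j - δ (τ j)) (τ j + δ (τ j))

/-- The integral sum of `G` for the tagged partition given by `n`, `α`, `τ`. -/
def kurzweilSum (G : ℝ → ℝ → X) (n : ℕ) (α τ : ℕ → ℝ) : X :=
  ∑ j ∈ Finset.range n, (G (τ j) (α (j + 1)) - G (τ j) (α j))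

/-- `G` is Kurzweil integrable on the compact interval `[a, b]`, `a ≤ b`, with integral `I`. -/
def HasKurzweilIntegralOn (G : ℝ → ℝ → X) (a b : ℝ) (I : X) : Prop :=
  ∀ ε > 0, ∃ δ : ℝ → ℝ, IsGauge a b δ ∧
    ∀ (n : ℕ) (α τ : ℕ → ℝ), IsTaggedPartition a b n α τ → IsFine δ n α τ →
      ‖kurzweilSum G n α τ - I‖ < ε

/-- The oriented Kurzweil integral `∫_a^b D G(τ, t)` exists and equals `I`; if `b < a` this
means that `∫_b^a D G(τ, t)` exists and equals `-I`. If `a = b` then the only partition has no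
intervals, so both clauses say that `I = 0`. -/
def HasKurzweilIntegral (G : ℝ → ℝ → X) (a b : ℝ) (I : X) : Prop :=
  (a ≤ b → HasKurzweilIntegralOn G a b I) ∧ (b ≤ a → HasKurzweilIntegralOn G b a (-I))

end KurzweilIntegral

section Equation

variable {E : Type*} [NormedAddCommGroup E] [NormedSpace ℝ E]

/-- `x` is a solution on the interval `J` of the generalized differential equation
`dx/dτ = D F(x, t)`. -/
def IsGODESolution (F : E → ℝ → E) (J : Set ℝ) (x : ℝ → E) : Prop :=
  ∀ c d : ℝ, c ≤ d → Icc c d ⊆ J →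
    HasKurzweilIntegral (fun τ t => F (x τ) t) c d (x d - x c)

/-- `x` is a solution on the interval `J` of the homogeneous generalized linear differential
equation `dx/dτ = D[A(t) x]`. -/
def IsSolution (A : ℝ → E →L[ℝ] E) (J : Set ℝ) (x : ℝ → E) : Prop :=
  IsGODESolution (fun y t => A t y) J x

/-- Condition (D): `I - Δ⁻A(t)` is invertible for all `t > 0` and `I + Δ⁺A(t)` is invertible for
all `t ≥ 0`, where `Δ⁻A(t) = A(t) - A(t⁻)` and `Δ⁺A(t) = A(t⁺) - A(t)`. -/
def ConditionD (A : ℝ → E →L[ℝ] E) : Prop :=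
  (∀ t > 0, IsUnit (1 - (A t - Function.leftLim A t))) ∧
    ∀ t ≥ 0, IsUnit (1 + (Function.rightLim A t - A t))

/-- `U` satisfies `U(t, s) = I + ∫_s^t d[A(r)] U(r, s)` for all `t, s ≥ 0`. -/
def IsTransitionMatrix (A : ℝ → E →L[ℝ] E) (U : ℝ → ℝ → E →L[ℝ] E) : Prop :=
  ∀ t ≥ 0, ∀ s ≥ 0, HasKurzweilIntegral (fun τ r => A r * U τ s) s t (U t s - 1)

/-- The transition matrix `U(t, s)` of `dx/dτ = D[A(t) x]`. For `A` of locally bounded variation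
on `[0, ∞)` with condition (D), on a finite-dimensional space, there is one function on
`[0, ∞) × [0, ∞)` with the defining property, and this is the function that is chosen; its values
at other arguments are irrelevant. -/
noncomputable def transitionMatrix (A : ℝ → E →L[ℝ] E) : ℝ → ℝ → E →L[ℝ] E :=
  Classical.epsilon (IsTransitionMatrix A)

/-- The trivial solution of `dx/dτ = D[A(t) x]` is stable: for all `s₀ ≥ 0` and `ε > 0` there is
`δ > 0` such that the solution on `[s₀, ∞)` with `x(s₀) = x₀`, `‖x₀‖ < δ`, stays below `ε`. -/
def IsStable (A : ℝ → E →L[ℝ] E) : Prop :=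
  ∀ s₀ ≥ 0, ∀ ε > 0, ∃ δ > 0, ∀ x₀ : E, ‖x₀‖ < δ →
    ∀ x : ℝ → E, IsSolution A (Ici s₀) x → x s₀ = x₀ → ∀ t ≥ s₀, ‖x t‖ < ε

end Equation

end GLDE

/-!
The solution with `x s = x₀` is `t ↦ U t s x₀`, so stability says that the operators `U t s`,
`t ≥ s`, are equicontinuous at `0`, which for linear maps is uniform boundedness of their norms.

That `U` exists and that solutions are unique is local in time, since by compactness it suffices
to treat `[t, s]` and `[s, t]` for `s` close to `t`. Apart from the jump of `A` at `t`, the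
variation of `A` on such an interval is small, and Picard iteration contracts. The jump acts on the
solutions by `x t⁺ = (1 + Δ⁺A t) (x t)`, or `x t⁻ = (1 - Δ⁻A t) (x t)`, and these maps are
invertible. The transition matrix itself is the solution of the linear equation with the coefficient
`X ↦ A t * X` on the space of operators.
-/

namespace GLDE

open Filter Topology

section Cousin

variable {a b : ℝ}

/-- If `P` fails on `[a, b]`, the supremum of the points up to which it holds cannot be passed by
`hright`, yet is reached by `hleft`. -/
theorem cousin_induction {P : ℝ → ℝ → Prop} (hab : a ≤ b) (hrefl : ∀ t, P t t)
    (htrans : ∀ r s t, r ≤ s → s ≤ t → P r s → P s t → P r t)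
    (hright : ∀ t ∈ Ico a b, ∀ᶠ s in 𝓝[>] t, P t s)
    (hleft : ∀ t ∈ Ioc a b, ∀ᶠ s in 𝓝[<] t, P s t) : P a b := by
  set S := {t ∈ Icc a b | P a t}
  have haS : a ∈ S := ⟨⟨le_rfl, hab⟩, hrefl a⟩
  obtain ⟨c, hS⟩ : ∃ c, IsLUB S c := ⟨_, isLUB_csSup ⟨a, haS⟩ ⟨b, fun t ht => ht.1.2⟩⟩
  have hac : a ≤ c := hS.1 haS
  have hcb : c ≤ b := hS.2 fun t ht => ht.1.2
  have hPc : P a c := by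
    by_cases hcS : c ∈ S
    · exact hcS.2
    have hac : a < c := hac.lt_of_ne fun h => hcS (h ▸ haS)
    have hfreq : ∃ᶠ s in 𝓝[<] c, s ∈ S := by
      have := hS.frequently_mem ⟨a, haS⟩
      rw [← Iio_insert, nhdsWithin_insert, frequently_sup] at this
      exact this.resolve_left (by simpa using hcS)
    obtain ⟨s, ⟨hsS, hs⟩, hsc⟩ :=
      ((hfreq.and_eventually (hleft c ⟨hac, hcb⟩)).and_eventually self_mem_nhdsWithin).exists
    exact htrans a s c hsS.1.1 (le_of_lt hsc) hsS.2 hs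
  rcases hcb.eq_or_lt with rfl | hcb
  · exact hPc
  obtain ⟨s, hs, hcs⟩ := ((hright c ⟨hac, hcb⟩).and (Ioc_mem_nhdsGT hcb)).exists
  have hsS : s ∈ S := ⟨⟨hac.trans hcs.1.le, hcs.2⟩, htrans a c s hac hcs.1.le hPc hs⟩
  exact absurd (hS.1 hsS) (not_le.2 hcs.1)

theorem eventually_nhdsGT_forall_Ioc {p : ℝ → Prop} (h : ∀ᶠ s in 𝓝[>] a, p s) :
    ∀ᶠ s in 𝓝[>] a, ∀ q ∈ Ioc a s, p q := by
  obtain ⟨u, hu, hp⟩ := mem_nhdsGT_iff_exists_Ioo_subset.1 h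
  filter_upwards [Ioo_mem_nhdsGT hu] with s hs q hq using hp ⟨hq.1, hq.2.trans_lt hs.2⟩

theorem eventually_nhdsLT_forall_Ico {p : ℝ → Prop} (h : ∀ᶠ s in 𝓝[<] a, p s) :
    ∀ᶠ s in 𝓝[<] a, ∀ q ∈ Ico s a, p q := by
  obtain ⟨u, hu, hp⟩ := mem_nhdsLT_iff_exists_Ioo_subset.1 h
  filter_upwards [Ioo_mem_nhdsLT hu] with s hs q hq using hp ⟨hs.1.trans_le hq.1, hq.2⟩

end Cousin

section FineDivisions

variable {X Y : Type*} [NormedAddCommGroup X] [NormedAddCommGroup Y]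
  {G H : ℝ → ℝ → X} {δ : ℝ → ℝ} {a b c τ : ℝ} {P Q : List (ℝ × ℝ × ℝ)}

/-- A `δ`-fine tagged division of `[a, b]`, listed from left to right; the triple `(τ, s, t)` is
the interval `[s, t]` with the tag `τ`. -/
inductive IsFineDivision (δ : ℝ → ℝ) : ℝ → ℝ → List (ℝ × ℝ × ℝ) → Prop
  | nil (a : ℝ) : IsFineDivision δ a a []
  | cons {a b c τ : ℝ} {P : List (ℝ × ℝ × ℝ)} (lt : a < b) (tag : τ ∈ Icc a b)
      (fine : Icc a b ⊆ Ioo (τ - δ τ) (τ + δ τ)) (tail : IsFineDivision δ b c P) :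
      IsFineDivision δ a c ((τ, a, b) :: P)

/-- The integral sum of `G` over a tagged division. -/
def integralSum (G : ℝ → ℝ → X) (P : List (ℝ × ℝ × ℝ)) : X :=
  (P.map fun p => G p.1 p.2.2 - G p.1 p.2.1).sum

@[simp]
theorem integralSum_nil : integralSum G [] = 0 := rfl

@[simp]
theorem integralSum_cons {s t : ℝ} :
    integralSum G ((τ, s, t) :: P) = G τ t - G τ s + integralSum G P := by
  simp [integralSum]

@[simp]
theorem integralSum_append : integralSum G (P ++ Q) = integralSum G P + integralSum G Q := by
  simp [integralSum]

theorem integralSum_sub (P : List (ℝ × ℝ × ℝ)) :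
    integralSum (fun τ t => G τ t - H τ t) P = integralSum G P - integralSum H P := by
  induction P with
  | nil => simp
  | cons p P ih =>
    obtain ⟨τ, s, t⟩ := p
    simp only [integralSum_cons, ih, sub_sub_sub_comm, add_sub_add_comm]

theorem integralSum_map {Φ : Type*} [FunLike Φ X Y] [AddMonoidHomClass Φ X Y] (φ : Φ)
    (P : List (ℝ × ℝ × ℝ)) : integralSum (fun τ t => φ (G τ t)) P = φ (integralSum G P) := by
  simp [integralSum, map_list_sum, Function.comp_def]

/-- The mirror image of a tagged division. -/
def reflectDivision (P : List (ℝ × ℝ × ℝ)) : List (ℝ × ℝ × ℝ) :=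
  (P.map fun p => (-p.1, -p.2.2, -p.2.1)).reverse

theorem integralSum_reflect (P : List (ℝ × ℝ × ℝ)) :
    integralSum (fun τ t => G (-τ) (-t)) P = -integralSum G (reflectDivision P) := by
  simp [integralSum, reflectDivision, List.sum_neg, Function.comp_def, List.sum_reverse]

namespace IsFineDivision

theorem single (hab : a < b) (hτ : τ ∈ Icc a b) (h : Icc a b ⊆ Ioo (τ - δ τ) (τ + δ τ)) :
    IsFineDivision δ a b [(τ, a, b)] :=
  .cons hab hτ h (.nil b)

theorem le (h : IsFineDivision δ a b P) : a ≤ b := by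
  induction h with
  | nil => exact le_rfl
  | cons hab _ _ _ ih => exact hab.le.trans ih

theorem mono (h : IsFineDivision δ a b P) {δ' : ℝ → ℝ} (hδ : ∀ t ∈ Icc a b, δ t ≤ δ' t) :
    IsFineDivision δ' a b P := by
  induction h with
  | nil => exact .nil _
  | @cons _ _ _ τ _ hab hτ hfine tail ih =>
    have hδτ := hδ τ ⟨hτ.1, hτ.2.trans tail.le⟩
    exact .cons hab hτ (hfine.trans (Ioo_subset_Ioo (by linarith) (by linarith)))
      (ih fun t ht => hδ t ⟨hab.le.trans ht.1, ht.2⟩)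

theorem append (hP : IsFineDivision δ a b P) (hQ : IsFineDivision δ b c Q) :
    IsFineDivision δ a c (P ++ Q) := by
  induction hP with
  | nil => exact hQ
  | cons hab hτ hfine _ ih => exact .cons hab hτ hfine (ih hQ)

theorem reflect (h : IsFineDivision δ a b P) :
    IsFineDivision (fun t => δ (-t)) (-b) (-a) (reflectDivision P) := by
  induction h with
  | nil => exact .nil _
  | cons hab hτ hfine _ ih =>
    simp only [reflectDivision, List.map_cons, List.reverse_cons]
    refine ih.append (.single (neg_lt_neg hab) ⟨neg_le_neg hτ.2, neg_le_neg hτ.1⟩ fun t ht => ?_)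
    have := hfine ⟨le_neg.2 ht.2, neg_le.2 ht.1⟩
    simp only [neg_neg, mem_Ioo] at this ⊢
    constructor <;> linarith

theorem eq_nil (h : IsFineDivision δ a a P) : P = [] := by
  cases h with
  | nil => rfl
  | cons hab _ _ tail => exact absurd tail.le (not_le.2 hab)

theorem exists_of_isGauge (hδ : IsGauge a b δ) (hab : a ≤ b) : ∃ P, IsFineDivision δ a b P := by
  refine cousin_induction (P := fun s t => ∃ P, IsFineDivision δ s t P) hab
    (fun t => ⟨_, .nil t⟩) (fun r s t _ _ ⟨_, hP⟩ ⟨_, hQ⟩ => ⟨_, hP.append hQ⟩)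
    (fun t ht => ?_) (fun t ht => ?_)
  · have hδt := hδ t (Ico_subset_Icc_self ht)
    filter_upwards [Ioo_mem_nhdsGT (lt_add_of_pos_right t hδt)] with s hs
    exact ⟨_, .single hs.1 ⟨le_rfl, hs.1.le⟩
      fun q hq => ⟨by linarith [hq.1], hq.2.trans_lt hs.2⟩⟩
  · have hδt := hδ t (Ioc_subset_Icc_self ht)
    filter_upwards [Ioo_mem_nhdsLT (sub_lt_self t hδt)] with s hs
    exact ⟨_, .single hs.2 ⟨hs.2.le, le_rfl⟩
      fun q hq => ⟨hs.1.trans_le hq.1, by linarith [hq.2]⟩⟩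

theorem integralSum_congr (h : IsFineDivision δ a b P)
    (hGH : ∀ τ ∈ Icc a b, ∀ t ∈ Icc a b, G τ t = H τ t) : integralSum G P = integralSum H P := by
  induction h with
  | nil => rfl
  | cons hab hτ _ tail ih =>
    have hbc := tail.le
    rw [integralSum_cons, integralSum_cons, ih fun τ hτ t ht =>
        hGH τ ⟨hab.le.trans hτ.1, hτ.2⟩ t ⟨hab.le.trans ht.1, ht.2⟩,
      hGH _ ⟨hτ.1, hτ.2.trans hbc⟩ _ ⟨hab.le, hbc⟩,
      hGH _ ⟨hτ.1, hτ.2.trans hbc⟩ _ ⟨le_rfl, hab.le.trans hbc⟩]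

theorem integralSum_const (h : IsFineDivision δ a b P) (g : ℝ → X) :
    integralSum (fun _ => g) P = g b - g a := by
  induction h with
  | nil => simp
  | cons _ _ _ _ ih => rw [integralSum_cons, ih, add_comm, sub_add_sub_cancel]

theorem norm_integralSum_le (h : IsFineDivision δ a b P) {w : ℝ → ℝ}
    (hG : ∀ τ s t, a ≤ s → s ≤ τ → τ ≤ t → t ≤ b → ‖G τ t - G τ s‖ ≤ w t - w s) :
    ‖integralSum G P‖ ≤ w b - w a := by
  induction h with
  | nil => simp
  | cons hab hτ _ tail ih =>
    rw [integralSum_cons]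
    have h₁ := hG _ _ _ le_rfl hτ.1 hτ.2 tail.le
    have h₂ := ih fun τ s t hs hsτ hτt ht => hG τ s t (hab.le.trans hs) hsτ hτt ht
    linarith [norm_add_le_of_le h₁ h₂]

/-- A gauge that is less than the distance to `b` forces `b` to be a tag, and the interval tagged
by `b` may be cut there without changing the integral sum. -/
theorem split (h : IsFineDivision δ a c P) (hδ : ∀ t ≠ b, δ t ≤ |t - b|) (hab : a ≤ b)
    (hbc : b ≤ c) : ∃ P₁ P₂, IsFineDivision δ a b P₁ ∧ IsFineDivision δ b c P₂ ∧
      ∀ G : ℝ → ℝ → X, integralSum G P = integralSum G P₁ + integralSum G P₂ := by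
  induction h with
  | nil =>
    obtain rfl := le_antisymm hab hbc
    exact ⟨[], [], .nil _, .nil _, by simp⟩
  | @cons a d c τ P had hτ hfine tail ih =>
    rcases le_or_gt d b with hdb | hbd
    · obtain ⟨P₁, P₂, h₁, h₂, hsum⟩ := ih hdb hbc
      exact ⟨_, _, .cons had hτ hfine h₁, h₂, fun G => by simp [hsum, add_assoc]⟩
    rcases hab.eq_or_lt with rfl | hab
    · exact ⟨_, _, .nil _, .cons had hτ hfine tail, by simp⟩
    obtain rfl : τ = b := by
      by_contra hτb
      have hb := hfine ⟨hab.le, hbd.le⟩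
      exact absurd (abs_sub_lt_iff.2 ⟨by linarith [hb.1], by linarith [hb.2]⟩)
        (not_lt.2 (hδ τ hτb))
    exact ⟨_, _, .single hab ⟨hab.le, le_rfl⟩ ((Icc_subset_Icc_right hbd.le).trans hfine),
      .cons hbd ⟨le_rfl, hbd.le⟩ ((Icc_subset_Icc_left hab.le).trans hfine) tail,
      fun G => by simp only [integralSum_cons, integralSum_nil]; abel⟩

theorem of_isTaggedPartition {n : ℕ} {α σ : ℕ → ℝ} (h : IsTaggedPartition a b n α σ)
    (hfine : IsFine δ n α σ) :
    IsFineDivision δ a b ((List.range n).map fun j => (σ j, α j, α (j + 1))) := by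
  obtain ⟨rfl, rfl, hlt, htag⟩ := h
  induction n with
  | zero => exact .nil _
  | succ n ih =>
    rw [List.range_succ, List.map_append]
    exact (ih (fun j hj => hfine j (hj.trans n.lt_succ_self))
      (fun j hj => hlt j (hj.trans n.lt_succ_self))
      (fun j hj => htag j (hj.trans n.lt_succ_self))).append
      (.single (hlt n n.lt_succ_self) (htag n n.lt_succ_self) (hfine n n.lt_succ_self))

theorem exists_isTaggedPartition (h : IsFineDivision δ a b P) :
    ∃ n α σ, IsTaggedPartition a b n α σ ∧ IsFine δ n α σ ∧
      P = (List.range n).map fun j => (σ j, α j, α (j + 1)) := by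
  induction h with
  | nil a => exact ⟨0, fun _ => a, fun _ => a, ⟨rfl, rfl, by simp, by simp⟩, by simp [IsFine], rfl⟩
  | @cons a b c τ P hab hτ hfine _ ih =>
    obtain ⟨n, α, σ, ⟨rfl, rfl, hlt, htag⟩, hσ, rfl⟩ := ih
    refine ⟨n + 1, fun j => j.casesOn a α, fun j => j.casesOn τ σ,
      ⟨rfl, rfl, fun j hj => ?_, fun j hj => ?_⟩, fun j hj => ?_,
      by simp [List.range_succ_eq_map, Function.comp_def]⟩
    all_goals cases j with
      | zero => assumption
      | succ j => first | exact hlt j (by omega) | exact htag j (by omega) | exact hσ j (by omega)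

end IsFineDivision

theorem integralSum_map_range (G : ℝ → ℝ → X) (n : ℕ) (α σ : ℕ → ℝ) :
    integralSum G ((List.range n).map fun j => (σ j, α j, α (j + 1))) = kurzweilSum G n α σ := by
  rw [integralSum, List.map_map]
  rfl

end FineDivisions

section Integral

variable {X Y : Type*} [NormedAddCommGroup X] [NormedAddCommGroup Y]
  {G H : ℝ → ℝ → X} {x y : ℝ → X} {I J K : X} {a b c : ℝ} {s : Set ℝ}

/-- The filter of arbitrarily fine tagged divisions of `[a, b]`. The Kurzweil integral is the limit
of the integral sums along it. -/
def fineDivisions (a b : ℝ) : Filter (List (ℝ × ℝ × ℝ)) :=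
  ⨅ (δ : ℝ → ℝ) (_ : IsGauge a b δ), 𝓟 {P | IsFineDivision δ a b P}

theorem hasBasis_fineDivisions (a b : ℝ) :
    (fineDivisions a b).HasBasis (IsGauge a b) fun δ => {P | IsFineDivision δ a b P} :=
  hasBasis_biInf_principal'
    (fun δ hδ δ' hδ' => ⟨fun t => min (δ t) (δ' t), fun t ht => lt_min (hδ t ht) (hδ' t ht),
      fun _ hP => hP.mono fun _ _ => min_le_left _ _,
      fun _ hP => hP.mono fun _ _ => min_le_right _ _⟩)
    ⟨fun _ => 1, fun _ _ => one_pos⟩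

theorem IsGauge.eventually_isFineDivision {δ : ℝ → ℝ} (hδ : IsGauge a b δ) :
    ∀ᶠ P in fineDivisions a b, IsFineDivision δ a b P :=
  (hasBasis_fineDivisions a b).mem_of_mem hδ

theorem eventually_exists_isFineDivision (a b : ℝ) :
    ∀ᶠ P in fineDivisions a b, ∃ δ, IsFineDivision δ a b P :=
  (IsGauge.eventually_isFineDivision fun _ _ => one_pos).mono fun _ hP => ⟨fun _ => 1, hP⟩

theorem fineDivisions_neBot (hab : a ≤ b) : (fineDivisions a b).NeBot :=
  (hasBasis_fineDivisions a b).neBot_iff.2 fun hδ => IsFineDivision.exists_of_isGauge hδ hab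

theorem IsGauge.exists_forall_le_abs_sub {δ₁ δ₂ : ℝ → ℝ} (h₁ : IsGauge a b δ₁)
    (h₂ : IsGauge b c δ₂) : ∃ δ, IsGauge a c δ ∧ (∀ t ≠ b, δ t ≤ |t - b|) ∧
      (∀ t ∈ Icc a b, δ t ≤ δ₁ t) ∧ ∀ t ∈ Icc b c, δ t ≤ δ₂ t := by
  refine ⟨fun t => if t < b then min (δ₁ t) (b - t)
    else if b < t then min (δ₂ t) (t - b) else min (δ₁ t) (δ₂ t), fun t ht => ?_, fun t htb => ?_,
      fun t ht => ?_, fun t ht => ?_⟩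
  · rcases lt_trichotomy t b with htb | rfl | hbt
    · simp [htb, h₁ t ⟨ht.1, htb.le⟩]
    · simp [h₁ t ⟨ht.1, le_rfl⟩, h₂ t ⟨le_rfl, ht.2⟩]
    · simp [hbt, hbt.not_gt, h₂ t ⟨hbt.le, ht.2⟩]
  · rcases htb.lt_or_gt with htb | hbt
    · simp [htb, abs_sub_comm t, le_abs_self]
    · simp [hbt, hbt.not_gt, le_abs_self]
  · rcases ht.2.lt_or_eq with htb | rfl <;> simp [*]
  · rcases ht.1.lt_or_eq with hbt | rfl
    · simp [hbt, hbt.not_gt]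
    · simp

theorem tendsto_append_fineDivisions (hab : a ≤ b) (hbc : b ≤ c) :
    Tendsto (fun p : List (ℝ × ℝ × ℝ) × List (ℝ × ℝ × ℝ) => p.1 ++ p.2)
      (fineDivisions a b ×ˢ fineDivisions b c) (fineDivisions a c) := by
  refine (hasBasis_fineDivisions a c).tendsto_right_iff.2 fun δ hδ => ?_
  have h₁ : IsGauge a b δ := fun t ht => hδ t ⟨ht.1, ht.2.trans hbc⟩
  have h₂ : IsGauge b c δ := fun t ht => hδ t ⟨hab.trans ht.1, ht.2⟩
  filter_upwards [prod_mem_prod h₁.eventually_isFineDivision h₂.eventually_isFineDivision]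
    with p hp using IsFineDivision.append hp.1 hp.2

theorem tendsto_reflectDivision (a b : ℝ) :
    Tendsto reflectDivision (fineDivisions (-b) (-a)) (fineDivisions a b) := by
  refine (hasBasis_fineDivisions a b).tendsto_right_iff.2 fun δ hδ => ?_
  have hδ' : IsGauge (-b) (-a) fun t => δ (-t) :=
    fun t ht => hδ _ ⟨le_neg.2 ht.2, neg_le.2 ht.1⟩
  filter_upwards [hδ'.eventually_isFineDivision] with P hP
  simpa using hP.reflect

theorem hasKurzweilIntegralOn_iff_tendsto :
    HasKurzweilIntegralOn G a b I ↔ Tendsto (integralSum G) (fineDivisions a b) (𝓝 I) := by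
  rw [(hasBasis_fineDivisions a b).tendsto_iff Metric.nhds_basis_ball]
  refine forall₂_congr fun ε _ => exists_congr fun δ => and_congr_right fun _ => ?_
  simp only [mem_ball_iff_norm, mem_ofPred_eq]
  constructor
  · intro h P hP
    obtain ⟨n, α, σ, hα, hσ, rfl⟩ := hP.exists_isTaggedPartition
    simpa only [integralSum_map_range] using h n α σ hα hσ
  · intro h n α σ hα hσ
    simpa only [integralSum_map_range] using h _ (.of_isTaggedPartition hα hσ)

theorem HasKurzweilIntegralOn.tendsto (h : HasKurzweilIntegralOn G a b I) :
    Tendsto (integralSum G) (fineDivisions a b) (𝓝 I) :=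
  hasKurzweilIntegralOn_iff_tendsto.1 h

theorem hasKurzweilIntegralOn_self : HasKurzweilIntegralOn G a a I ↔ I = 0 := by
  have := fineDivisions_neBot (le_refl a)
  have h : integralSum G =ᶠ[fineDivisions a a] fun _ => 0 := by
    filter_upwards [eventually_exists_isFineDivision a a] with P ⟨_, hP⟩
    rw [hP.eq_nil, integralSum_nil]
  rw [hasKurzweilIntegralOn_iff_tendsto, tendsto_congr' h, tendsto_const_nhds_iff, eq_comm]

theorem hasKurzweilIntegralOn_const (g : ℝ → X) (a b : ℝ) :
    HasKurzweilIntegralOn (fun _ => g) a b (g b - g a) := by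
  refine hasKurzweilIntegralOn_iff_tendsto.2 (tendsto_const_nhds.congr' ?_)
  filter_upwards [eventually_exists_isFineDivision a b] with P ⟨_, hP⟩
  exact (hP.integralSum_const g).symm

namespace HasKurzweilIntegralOn

theorem congr (h : HasKurzweilIntegralOn G a b I)
    (hGH : ∀ τ ∈ Icc a b, ∀ t ∈ Icc a b, G τ t = H τ t) : HasKurzweilIntegralOn H a b I := by
  refine hasKurzweilIntegralOn_iff_tendsto.2 (h.tendsto.congr' ?_)
  filter_upwards [eventually_exists_isFineDivision a b] with P ⟨_, hP⟩
  exact hP.integralSum_congr hGH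

theorem sub (hG : HasKurzweilIntegralOn G a b I) (hH : HasKurzweilIntegralOn H a b J) :
    HasKurzweilIntegralOn (fun τ t => G τ t - H τ t) a b (I - J) :=
  hasKurzweilIntegralOn_iff_tendsto.2 <|
    (hG.tendsto.sub hH.tendsto).congr fun P => (integralSum_sub P).symm

theorem map {Φ : Type*} [FunLike Φ X Y] [AddMonoidHomClass Φ X Y]
    (h : HasKurzweilIntegralOn G a b I) (φ : Φ) (hφ : Continuous φ) :
    HasKurzweilIntegralOn (fun τ t => φ (G τ t)) a b (φ I) :=
  hasKurzweilIntegralOn_iff_tendsto.2 <|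
    ((hφ.tendsto I).comp h.tendsto).congr fun P => (integralSum_map φ P).symm

theorem reflect (h : HasKurzweilIntegralOn G a b I) :
    HasKurzweilIntegralOn (fun τ t => G (-τ) (-t)) (-b) (-a) (-I) :=
  hasKurzweilIntegralOn_iff_tendsto.2 <|
    (h.tendsto.comp (tendsto_reflectDivision a b)).neg.congr fun P => (integralSum_reflect P).symm

theorem norm_le (h : HasKurzweilIntegralOn G a b I) (hab : a ≤ b) {w : ℝ → ℝ}
    (hG : ∀ τ s t, a ≤ s → s ≤ τ → τ ≤ t → t ≤ b → ‖G τ t - G τ s‖ ≤ w t - w s) :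
    ‖I‖ ≤ w b - w a := by
  have := fineDivisions_neBot hab
  refine le_of_tendsto h.tendsto.norm ?_
  filter_upwards [eventually_exists_isFineDivision a b] with P ⟨_, hP⟩
  exact hP.norm_integralSum_le hG

theorem concat (hI : HasKurzweilIntegralOn G a b I) (hJ : HasKurzweilIntegralOn G b c J)
    (hab : a ≤ b) (hbc : b ≤ c) : HasKurzweilIntegralOn G a c (I + J) := by
  rw [hasKurzweilIntegralOn_iff_tendsto]
  intro u hu
  have h := (hI.tendsto.comp tendsto_fst).add (hJ.tendsto.comp tendsto_snd) hu
  obtain ⟨⟨δ₁, δ₂⟩, ⟨hδ₁, hδ₂⟩, hu⟩ :=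
    ((hasBasis_fineDivisions a b).prod (hasBasis_fineDivisions b c)).mem_iff.1 h
  obtain ⟨δ, hδ, hδb, hle₁, hle₂⟩ := hδ₁.exists_forall_le_abs_sub hδ₂
  refine mem_map.2 ?_
  filter_upwards [hδ.eventually_isFineDivision] with P hP
  obtain ⟨P₁, P₂, h₁, h₂, hsum⟩ := hP.split (X := X) hδb hab hbc
  rw [mem_preimage, hsum]
  exact hu (mk_mem_prod (h₁.mono hle₁) (h₂.mono hle₂))

theorem sub_left (hac : HasKurzweilIntegralOn G a c I) (hab : HasKurzweilIntegralOn G a b J)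
    (h₁ : a ≤ b) (h₂ : b ≤ c) : HasKurzweilIntegralOn G b c (I - J) := by
  have := fineDivisions_neBot h₁
  have h := (hac.tendsto.comp (tendsto_append_fineDivisions h₁ h₂)).sub
    (hab.tendsto.comp tendsto_fst)
  rw [hasKurzweilIntegralOn_iff_tendsto, ← map_snd_prod (fineDivisions a b) (fineDivisions b c),
    tendsto_map'_iff]
  simpa [Function.comp_def] using h

theorem of_eq_zero_Ioc (hab : a < b) (hG : ∀ τ ∈ Ioc a b, ∀ t ∈ Ioc a b, G τ t = 0)
    (hJ : Tendsto (fun t => G a t - G a a) (𝓝[>] a) (𝓝 J)) : HasKurzweilIntegralOn G a b J := by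
  rw [hasKurzweilIntegralOn_iff_tendsto]
  intro u hu
  obtain ⟨d, hd, hdu⟩ := mem_nhdsGT_iff_exists_Ioo_subset.1 (hJ hu)
  have hd : a < d := hd
  have hδ : IsGauge a b fun t => if t = a then d - a else t - a := by
    intro t ht
    dsimp only
    split_ifs with hta
    · exact sub_pos.2 hd
    · exact sub_pos.2 (ht.1.lt_of_ne' hta)
  refine mem_map.2 ?_
  filter_upwards [hδ.eventually_isFineDivision] with P hP
  cases hP with
  | nil => exact absurd hab (lt_irrefl _)
  | @cons _ t _ τ P hat hτ hfine tail =>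
    obtain rfl : τ = a := by
      by_contra hτa
      simpa [hτa] using (hfine ⟨le_rfl, hat.le⟩).1
    have htail : integralSum G P = 0 := by
      rw [tail.integralSum_congr fun σ hσ r hr =>
        hG σ ⟨hat.trans_le hσ.1, hσ.2⟩ r ⟨hat.trans_le hr.1, hr.2⟩]
      simpa using tail.integralSum_const fun _ => (0 : X)
    rw [mem_preimage, integralSum_cons, htail, add_zero]
    exact hdu ⟨hat, by simpa using (hfine ⟨hat.le, le_rfl⟩).2⟩

theorem change_left (h : HasKurzweilIntegralOn G a b I) (hab : a < b)
    (hGH : ∀ τ ∈ Ioc a b, ∀ t ∈ Ioc a b, G τ t = H τ t)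
    (hJ : Tendsto (fun t => G a t - G a a) (𝓝[>] a) (𝓝 J))
    (hK : Tendsto (fun t => H a t - H a a) (𝓝[>] a) (𝓝 K)) :
    HasKurzweilIntegralOn H a b (I - (J - K)) := by
  have hD : HasKurzweilIntegralOn (fun τ t => G τ t - H τ t) a b (J - K) :=
    of_eq_zero_Ioc hab (fun τ hτ t ht => sub_eq_zero.2 (hGH τ hτ t ht))
      ((hJ.sub hK).congr fun _ => sub_sub_sub_comm _ _ _ _)
  simpa using h.sub hD

end HasKurzweilIntegralOn

/-- `x` is a primitive of `G` on `s`: its increments are the Kurzweil integrals of `G`. -/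
def IsPrimitiveOn (G : ℝ → ℝ → X) (s : Set ℝ) (x : ℝ → X) : Prop :=
  ∀ c d, c ≤ d → Icc c d ⊆ s → HasKurzweilIntegralOn G c d (x d - x c)

namespace IsPrimitiveOn

theorem mono {s' : Set ℝ} (h : IsPrimitiveOn G s x) (hs : s' ⊆ s) : IsPrimitiveOn G s' x :=
  fun c d hcd hs' => h c d hcd (hs'.trans hs)

theorem congr (h : IsPrimitiveOn G s x) (hGH : ∀ τ ∈ s, ∀ t ∈ s, G τ t = H τ t)
    (hxy : EqOn x y s) : IsPrimitiveOn H s y := by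
  intro c d hcd hs
  rw [← hxy (hs (left_mem_Icc.2 hcd)), ← hxy (hs (right_mem_Icc.2 hcd))]
  exact (h c d hcd hs).congr fun τ hτ t ht => hGH τ (hs hτ) t (hs ht)

theorem sub (hx : IsPrimitiveOn G s x) (hy : IsPrimitiveOn H s y) :
    IsPrimitiveOn (fun τ t => G τ t - H τ t) s fun t => x t - y t := by
  intro c d hcd hs
  simpa only [sub_sub_sub_comm] using (hx c d hcd hs).sub (hy c d hcd hs)

theorem reflect (h : IsPrimitiveOn G (Icc a b) x) :
    IsPrimitiveOn (fun τ t => G (-τ) (-t)) (Icc (-b) (-a)) fun t => x (-t) := by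
  intro c d hcd hs
  obtain ⟨hc, hd⟩ := (Icc_subset_Icc_iff hcd).1 hs
  simpa using (h (-d) (-c) (neg_le_neg hcd) (Icc_subset_Icc (le_neg.2 hd) (neg_le.2 hc))).reflect

theorem of_left (h : ∀ t ∈ Icc a b, HasKurzweilIntegralOn G a t (x t - x a)) :
    IsPrimitiveOn G (Icc a b) x := by
  intro c d hcd hs
  simpa using (h d (hs (right_mem_Icc.2 hcd))).sub_left (h c (hs (left_mem_Icc.2 hcd)))
    (hs (left_mem_Icc.2 hcd)).1 hcd

theorem concat (h₁ : IsPrimitiveOn G (Icc a b) x) (h₂ : IsPrimitiveOn G (Icc b c) x)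
    (hab : a ≤ b) : IsPrimitiveOn G (Icc a c) x := by
  refine of_left fun t ht => ?_
  rcases le_total t b with htb | hbt
  · exact h₁ a t ht.1 (Icc_subset_Icc_right htb)
  · simpa using (h₁ a b hab Subset.rfl).concat (h₂ b t hbt (Icc_subset_Icc_right ht.2)) hab hbt

/-- A fine division of `[t, b]` preceded by the interval `[a, t]` with the tag `a` is a fine
division of `[a, b]`. -/
theorem tendsto_sub_nhdsGT (h : IsPrimitiveOn G (Icc a b) x) (hab : a < b) :
    Tendsto (fun t => x t - x a - (G a t - G a a)) (𝓝[>] a) (𝓝 0) := by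
  refine Metric.nhds_basis_closedBall.tendsto_right_iff.2 fun ε hε => ?_
  obtain ⟨δ, hδ, hsum⟩ := ((hasBasis_fineDivisions a b).tendsto_iff Metric.nhds_basis_closedBall).1
    (h a b hab.le Subset.rfl).tendsto ε hε
  filter_upwards [Ioo_mem_nhdsGT hab,
    Ioo_mem_nhdsGT (lt_add_of_pos_right a (hδ a ⟨le_rfl, hab.le⟩))]
    with t ht htδ
  have := fineDivisions_neBot ht.2.le
  have hfine : Icc a t ⊆ Ioo (a - δ a) (a + δ a) := fun q hq =>
    ⟨by linarith [hq.1, htδ.1, htδ.2], hq.2.trans_lt htδ.2⟩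
  have hδt : IsGauge t b δ := fun q hq => hδ q ⟨ht.1.le.trans hq.1, hq.2⟩
  have hlim : Tendsto (fun P => G a t - G a a + integralSum G P) (fineDivisions t b)
      (𝓝 (G a t - G a a + (x b - x t))) :=
    tendsto_const_nhds.add (h t b ht.2.le (Icc_subset_Icc_left ht.1.le)).tendsto
  have hmem : G a t - G a a + (x b - x t) ∈ Metric.closedBall (x b - x a) ε := by
    refine Metric.isClosed_closedBall.mem_of_tendsto hlim ?_
    filter_upwards [hδt.eventually_isFineDivision] with P hP
    rw [← integralSum_cons]
    exact hsum _ (hP.cons ht.1 ⟨le_rfl, ht.1.le⟩ hfine)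
  have heq : x t - x a - (G a t - G a a) - 0
      = -(G a t - G a a + (x b - x t) - (x b - x a)) := by abel
  rw [mem_closedBall_iff_norm] at hmem ⊢
  rwa [heq, norm_neg]

theorem tendsto_nhdsGT (h : IsPrimitiveOn G (Icc a b) x) (hab : a < b)
    (hJ : Tendsto (fun t => G a t - G a a) (𝓝[>] a) (𝓝 J)) :
    Tendsto x (𝓝[>] a) (𝓝 (x a + J)) := by
  simpa using ((h.tendsto_sub_nhdsGT hab).add hJ).const_add (x a)

theorem change_left (h : IsPrimitiveOn G (Icc a b) x)
    (hGH : ∀ τ ∈ Ioc a b, ∀ t ∈ Ioc a b, G τ t = H τ t)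
    (hJ : Tendsto (fun t => G a t - G a a) (𝓝[>] a) (𝓝 J))
    (hK : Tendsto (fun t => H a t - H a a) (𝓝[>] a) (𝓝 K))
    (hxy : EqOn x y (Ioc a b)) (ha : x a + J = y a + K) : IsPrimitiveOn H (Icc a b) y := by
  refine of_left fun t ht => ?_
  rcases ht.1.eq_or_lt with rfl | hat
  · exact hasKurzweilIntegralOn_self.2 (sub_self _)
  have hI := (h a t ht.1 (Icc_subset_Icc_right ht.2)).change_left hat
    (fun τ hτ q hq => hGH τ ⟨hτ.1, hτ.2.trans ht.2⟩ q ⟨hq.1, hq.2.trans ht.2⟩) hJ hK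
  convert hI using 1
  rw [hxy ⟨hat, ht.2⟩, sub_sub, ← add_sub_assoc, ha, add_sub_cancel_right]

end IsPrimitiveOn

end Integral

section ControlledBy

variable {X : Type*} [NormedAddCommGroup X] {A : ℝ → X} {v : ℝ → ℝ} {a t : ℝ}

/-- `A` has locally bounded variation, as witnessed by a nondecreasing function `v` whose increments
dominate those of `A`. -/
def IsControlledBy (A : ℝ → X) (v : ℝ → ℝ) : Prop :=
  ∀ s t, s ≤ t → ‖A t - A s‖ ≤ v t - v s

/-- `A` on `(a, ∞)`, continued to the left by the constant `A(a⁺)`. -/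
noncomputable def removeRightJump (A : ℝ → X) (a : ℝ) : ℝ → X :=
  fun t => if t ≤ a then Function.rightLim A a else A t

theorem removeRightJump_of_le (h : t ≤ a) : removeRightJump A a t = Function.rightLim A a :=
  if_pos h

theorem removeRightJump_of_lt (h : a < t) : removeRightJump A a t = A t :=
  if_neg (not_le.2 h)

namespace IsControlledBy

theorem monotone (h : IsControlledBy A v) : Monotone v := fun s t hst =>
  sub_nonneg.1 ((norm_nonneg _).trans (h s t hst))

theorem reflect (h : IsControlledBy A v) :
    IsControlledBy (fun t => A (-t)) (fun t => -v (-t)) := by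
  intro s t hst
  rw [norm_sub_rev, neg_sub_neg]
  exact h (-t) (-s) (neg_le_neg hst)

theorem dist_le (h : IsControlledBy A v) (s t : ℝ) : dist (A s) (A t) ≤ dist (v s) (v t) := by
  wlog hst : s ≤ t generalizing s t
  · simpa only [dist_comm] using this t s (le_of_not_ge hst)
  rw [dist_comm, dist_eq_norm, dist_comm, Real.dist_eq]
  exact (h s t hst).trans (le_abs_self _)

variable [CompleteSpace X]

theorem exists_tendsto (h : IsControlledBy A v) {l : Filter ℝ} [l.NeBot] {r : ℝ}
    (hl : Tendsto v l (𝓝 r)) : ∃ L, Tendsto A l (𝓝 L) := by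
  refine cauchy_map_iff_exists_tendsto.1 (cauchy_map_iff.2 ⟨‹_›, ?_⟩)
  rw [tendsto_uniformity_iff_dist_tendsto_zero]
  exact squeeze_zero (fun _ => dist_nonneg) (fun p => h.dist_le p.1 p.2)
    (tendsto_uniformity_iff_dist_tendsto_zero.1 (cauchy_map_iff.1 hl.cauchy_map).2)

theorem tendsto_rightLim (h : IsControlledBy A v) (t : ℝ) :
    Tendsto A (𝓝[>] t) (𝓝 (Function.rightLim A t)) :=
  tendsto_rightLim_of_tendsto (h.exists_tendsto (h.monotone.tendsto_rightLim t))

theorem tendsto_leftLim (h : IsControlledBy A v) (t : ℝ) :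
    Tendsto A (𝓝[<] t) (𝓝 (Function.leftLim A t)) :=
  tendsto_leftLim_of_tendsto (h.exists_tendsto (h.monotone.tendsto_leftLim t))

theorem removeRightJump (h : IsControlledBy A v) (a : ℝ) :
    IsControlledBy (removeRightJump A a) (removeRightJump v a) := by
  intro s t hst
  rcases le_or_gt t a with hta | hat
  · simp [removeRightJump_of_le, hta, hst.trans hta]
  rw [removeRightJump_of_lt hat, removeRightJump_of_lt hat]
  rcases le_or_gt s a with hsa | has
  · rw [removeRightJump_of_le hsa, removeRightJump_of_le hsa]
    refine le_of_tendsto_of_tendsto (tendsto_const_nhds.sub (h.tendsto_rightLim a)).norm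
      (tendsto_const_nhds.sub (h.monotone.tendsto_rightLim a)) ?_
    filter_upwards [Ioo_mem_nhdsGT hat] with q hq using h q t hq.2.le
  · rw [removeRightJump_of_lt has, removeRightJump_of_lt has]
    exact h s t hst

theorem tendsto_removeRightJump (h : IsControlledBy A v) (a : ℝ) :
    Tendsto (GLDE.removeRightJump A a) (𝓝[>] a) (𝓝 (Function.rightLim A a)) :=
  (h.tendsto_rightLim a).congr' <| eventually_mem_nhdsWithin.mono fun _ ht =>
    (removeRightJump_of_lt ht).symm

end IsControlledBy

end ControlledBy

section LinearIntegral

variable {E F : Type*} [NormedAddCommGroup E] [NormedSpace ℝ E] [NormedAddCommGroup F]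
  [NormedSpace ℝ F] {A : ℝ → E →L[ℝ] F} {v : ℝ → ℝ} {f : ℝ → E} {a b m : ℝ}

namespace IsControlledBy

theorem norm_apply_sub_le (hA : IsControlledBy A v) {y : E} (hy : ‖y‖ ≤ m) {s t : ℝ}
    (hst : s ≤ t) : ‖A t y - A s y‖ ≤ m * v t - m * v s := by
  rw [← mul_sub, mul_comm]
  exact (A t - A s).le_of_opNorm_le_of_le (hA s t hst) hy

theorem norm_integral_le (hA : IsControlledBy A v) (hab : a ≤ b)
    (hf : ∀ τ ∈ Icc a b, ‖f τ‖ ≤ m) {I : F}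
    (hI : HasKurzweilIntegralOn (fun τ t => A t (f τ)) a b I) : ‖I‖ ≤ m * (v b - v a) := by
  rw [mul_sub]
  exact hI.norm_le (w := fun t => m * v t) hab fun τ s t has hsτ hτt htb =>
    hA.norm_apply_sub_le (hf τ ⟨has.trans hsτ, hτt.trans htb⟩) (hsτ.trans hτt)

theorem tendstoUniformlyOnFilter_integralSum (hA : IsControlledBy A v) {g : ℕ → ℝ → E}
    (hab : a ≤ b) (hg : TendstoUniformlyOn g f atTop (Icc a b)) :
    TendstoUniformlyOnFilter (fun n => integralSum fun τ t => A t (g n τ))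
      (integralSum fun τ t => A t (f τ)) atTop (fineDivisions a b) := by
  refine Metric.tendstoUniformlyOnFilter_iff.2 fun ε hε => ?_
  have hv : 0 ≤ v b - v a := sub_nonneg.2 (hA.monotone hab)
  have hε' : 0 < ε / (v b - v a + 1) := by positivity
  filter_upwards [prod_mem_prod (Metric.tendstoUniformlyOn_iff.1 hg _ hε')
    (eventually_exists_isFineDivision a b)] with ⟨n, P⟩ ⟨hn, δ, hP⟩
  have hle := hP.norm_integralSum_le (G := fun τ t => A t (f τ - g n τ))
    (w := fun t => ε / (v b - v a + 1) * v t) fun τ s t has hsτ hτt htb =>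
      hA.norm_apply_sub_le (dist_eq_norm (f τ) _ ▸ (hn τ ⟨has.trans hsτ, hτt.trans htb⟩).le)
        (hsτ.trans hτt)
  simp only [map_sub, integralSum_sub] at hle
  calc _ ≤ ε / (v b - v a + 1) * (v b - v a) := by rwa [dist_eq_norm, mul_sub]
    _ < ε / (v b - v a + 1) * (v b - v a + 1) := by gcongr; linarith
    _ = ε := by field_simp

variable [CompleteSpace F]

theorem exists_integral_of_tendstoUniformlyOn (hA : IsControlledBy A v) {g : ℕ → ℝ → E}
    {I : ℕ → F} (hab : a ≤ b) (hg : TendstoUniformlyOn g f atTop (Icc a b))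
    (hI : ∀ n, HasKurzweilIntegralOn (fun τ t => A t (g n τ)) a b (I n)) :
    ∃ J, Tendsto I atTop (𝓝 J) ∧ HasKurzweilIntegralOn (fun τ t => A t (f τ)) a b J := by
  have := fineDivisions_neBot hab
  have hI := fun n => (hI n).tendsto
  have hu := hA.tendstoUniformlyOnFilter_integralSum hab hg
  have hcauchy : CauchySeq I := by
    refine cauchy_map_iff.2 ⟨inferInstance, uniformity_hasBasis_closed.tendsto_right_iff.2 ?_⟩
    rintro u ⟨hmem, hclosed⟩
    filter_upwards [(hu.uniformCauchySeqOnFilter u hmem).curry] with p hp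
    exact hclosed.mem_of_tendsto ((hI p.1).prodMk_nhds (hI p.2)) hp
  obtain ⟨J, hJ⟩ := cauchySeq_tendsto_of_complete hcauchy
  exact ⟨J, hJ, hasKurzweilIntegralOn_iff_tendsto.2
    (hu.tendsto_of_eventually_tendsto (.of_forall hI) hJ)⟩

theorem tendsto_apply_sub_nhdsGT (hA : IsControlledBy A v) (t : ℝ) (y : E) :
    Tendsto (fun s => A s y - A t y) (𝓝[>] t) (𝓝 ((Function.rightLim A t - A t) y)) :=
  (((ContinuousLinearMap.apply ℝ F y).continuous.tendsto _).comp
    (hA.tendsto_rightLim t)).sub_const _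

theorem exists_integral_of_eqOn_Ioc (hA : IsControlledBy A v) (hab : a ≤ b) {y : E}
    (hf : ∀ t ∈ Ioc a b, f t = y) :
    ∃ I, HasKurzweilIntegralOn (fun τ t => A t (f τ)) a b I := by
  rcases hab.eq_or_lt with rfl | hab
  · exact ⟨0, hasKurzweilIntegralOn_self.2 rfl⟩
  · exact ⟨_, (hasKurzweilIntegralOn_const (fun t => A t y) a b).change_left hab
      (fun τ hτ t _ => by rw [hf τ hτ]) (hA.tendsto_apply_sub_nhdsGT a y)
      (hA.tendsto_apply_sub_nhdsGT a (f a))⟩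

theorem exists_integral_of_eqOn_Ico (hA : IsControlledBy A v) (hab : a ≤ b) {y : E}
    (hf : ∀ t ∈ Ico a b, f t = y) :
    ∃ I, HasKurzweilIntegralOn (fun τ t => A t (f τ)) a b I := by
  obtain ⟨I, hI⟩ := hA.reflect.exists_integral_of_eqOn_Ioc (f := fun t => f (-t))
    (neg_le_neg hab) fun t ht => hf (-t) ⟨le_neg.2 ht.2, neg_lt.2 ht.1⟩
  exact ⟨-I, by simpa using hI.reflect⟩

theorem exists_integral_of_eqOn_Ioo (hA : IsControlledBy A v) (hab : a ≤ b) {y : E}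
    (hf : ∀ t ∈ Ioo a b, f t = y) :
    ∃ I, HasKurzweilIntegralOn (fun τ t => A t (f τ)) a b I := by
  rcases hab.eq_or_lt with rfl | hab
  · exact ⟨0, hasKurzweilIntegralOn_self.2 rfl⟩
  obtain ⟨c, hac, hcb⟩ := exists_between hab
  obtain ⟨I, hI⟩ := hA.exists_integral_of_eqOn_Ioc hac.le
    fun t ht => hf t ⟨ht.1, ht.2.trans_lt hcb⟩
  obtain ⟨J, hJ⟩ := hA.exists_integral_of_eqOn_Ico hcb.le
    fun t ht => hf t ⟨hac.trans_le ht.1, ht.2⟩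
  exact ⟨I + J, hI.concat hJ hac.le hcb.le⟩

end IsControlledBy

end LinearIntegral

section Regulated

variable {E : Type*} [NormedAddCommGroup E] {f : ℝ → E} {a b : ℝ}

theorem exists_eqOn_Iic_eqOn_Ici {X : Type*} {f g : ℝ → X} (h : f b = g b) :
    ∃ z, EqOn z f (Iic b) ∧ EqOn z g (Ici b) := by
  refine ⟨fun t => if t ≤ b then f t else g t, fun t ht => if_pos ht, fun t ht => ?_⟩
  rcases (mem_Ici.1 ht).eq_or_lt with rfl | hbt
  · simp [h]
  · exact if_neg (not_le.2 hbt)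

/-- `f` is regulated on `[a, b]`: it has one-sided limits there. -/
structure IsRegulatedOn (f : ℝ → E) (a b : ℝ) : Prop where
  exists_tendsto_nhdsGT : ∀ t ∈ Ico a b, ∃ L, Tendsto f (𝓝[>] t) (𝓝 L)
  exists_tendsto_nhdsLT : ∀ t ∈ Ioc a b, ∃ L, Tendsto f (𝓝[<] t) (𝓝 L)

namespace IsRegulatedOn

theorem const (y : E) (a b : ℝ) : IsRegulatedOn (fun _ => y) a b :=
  ⟨fun _ _ => ⟨y, tendsto_const_nhds⟩, fun _ _ => ⟨y, tendsto_const_nhds⟩⟩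

theorem mono {a' b' : ℝ} (h : IsRegulatedOn f a b) (ha : a ≤ a') (hb : b' ≤ b) :
    IsRegulatedOn f a' b' :=
  ⟨fun t ht => h.1 t ⟨ha.trans ht.1, ht.2.trans_le hb⟩,
    fun t ht => h.2 t ⟨ha.trans_lt ht.1, ht.2.trans hb⟩⟩

theorem sub {g : ℝ → E} (hf : IsRegulatedOn f a b) (hg : IsRegulatedOn g a b) :
    IsRegulatedOn (fun t => f t - g t) a b where
  exists_tendsto_nhdsGT t ht :=
    let ⟨_, hL⟩ := hf.1 t ht; let ⟨_, hM⟩ := hg.1 t ht; ⟨_, hL.sub hM⟩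
  exists_tendsto_nhdsLT t ht :=
    let ⟨_, hL⟩ := hf.2 t ht; let ⟨_, hM⟩ := hg.2 t ht; ⟨_, hL.sub hM⟩

theorem exists_norm_le (h : IsRegulatedOn f a b) (hab : a ≤ b) :
    ∃ m, ∀ t ∈ Icc a b, ‖f t‖ ≤ m := by
  have near : ∀ {L : E} {l : Filter ℝ}, Tendsto f l (𝓝 L) → ∀ᶠ q in l, ‖f q‖ ≤ ‖L‖ + 1 :=
    fun hL => (hL.norm.eventually_lt_const (lt_add_one _)).mono fun _ => le_of_lt
  refine cousin_induction (P := fun s t => ∃ m, ∀ q ∈ Icc s t, ‖f q‖ ≤ m) hab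
    (fun t => ⟨‖f t‖, by simp⟩) ?_ (fun t ht => ?_) (fun t ht => ?_)
  · rintro r s t - - ⟨m, hm⟩ ⟨n, hn⟩
    refine ⟨max m n, fun q hq => ?_⟩
    rcases le_total q s with hqs | hsq
    · exact (hm q ⟨hq.1, hqs⟩).trans (le_max_left _ _)
    · exact (hn q ⟨hsq, hq.2⟩).trans (le_max_right _ _)
  · obtain ⟨L, hL⟩ := h.1 t ht
    filter_upwards [eventually_nhdsGT_forall_Ioc (near hL)] with s hs
    refine ⟨max ‖f t‖ (‖L‖ + 1), fun q hq => ?_⟩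
    rcases hq.1.eq_or_lt with rfl | htq
    · exact le_max_left _ _
    · exact (hs q ⟨htq, hq.2⟩).trans (le_max_right _ _)
  · obtain ⟨L, hL⟩ := h.2 t ht
    filter_upwards [eventually_nhdsLT_forall_Ico (near hL)] with s hs
    refine ⟨max ‖f t‖ (‖L‖ + 1), fun q hq => ?_⟩
    rcases hq.2.eq_or_lt with rfl | hqt
    · exact le_max_left _ _
    · exact (hs q ⟨hq.1, hqt⟩).trans (le_max_right _ _)

end IsRegulatedOn

end Regulated

section RegulatedIntegral

variable {E F : Type*} [NormedAddCommGroup E] [NormedSpace ℝ E] [NormedAddCommGroup F]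
  [NormedSpace ℝ F] {A : ℝ → E →L[ℝ] F} {v : ℝ → ℝ} {f : ℝ → E} {x : ℝ → F} {a b c ε : ℝ}

/-- `f` can be approximated on `[a, b]` within `ε` by a function that is integrable with respect to
`A` and has the same values at the endpoints. -/
def HasIntegrableApprox (A : ℝ → E →L[ℝ] F) (f : ℝ → E) (ε a b : ℝ) : Prop :=
  ∃ g : ℝ → E, (∀ t ∈ Icc a b, dist (f t) (g t) ≤ ε) ∧ g a = f a ∧ g b = f b ∧
    ∃ I, HasKurzweilIntegralOn (fun τ t => A t (g τ)) a b I

theorem HasIntegrableApprox.trans (hab : a ≤ b) (hbc : b ≤ c) (h₁ : HasIntegrableApprox A f ε a b)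
    (h₂ : HasIntegrableApprox A f ε b c) : HasIntegrableApprox A f ε a c := by
  obtain ⟨g₁, hf₁, hga, hgb, I, hI⟩ := h₁
  obtain ⟨g₂, hf₂, hgb', hgc, J, hJ⟩ := h₂
  obtain ⟨g, hg₁, hg₂⟩ := exists_eqOn_Iic_eqOn_Ici (hgb.trans hgb'.symm)
  refine ⟨g, fun t ht => ?_, (hg₁ hab).trans hga, (hg₂ hbc).trans hgc, I + J,
    (hI.congr fun τ hτ t _ => by rw [hg₁ hτ.2]).concat
      (hJ.congr fun τ hτ t _ => by rw [hg₂ hτ.1]) hab hbc⟩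
  rcases le_total t b with htb | hbt
  · exact hg₁ htb ▸ hf₁ t ⟨ht.1, htb⟩
  · exact hg₂ hbt ▸ hf₂ t ⟨hbt, ht.2⟩

variable [CompleteSpace F]

namespace IsPrimitiveOn

theorem tendsto_nhdsGT_rightLim (h : IsPrimitiveOn (fun τ t => A t (f τ)) (Icc a b) x)
    (hA : IsControlledBy A v) (hab : a < b) :
    Tendsto x (𝓝[>] a) (𝓝 (x a + (Function.rightLim A a - A a) (f a))) :=
  h.tendsto_nhdsGT hab (hA.tendsto_apply_sub_nhdsGT a (f a))

theorem isRegulatedOn (h : IsPrimitiveOn (fun τ t => A t (f τ)) (Icc a b) x)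
    (hA : IsControlledBy A v) : IsRegulatedOn x a b := by
  refine ⟨fun t ht => ⟨_, (h.mono (Icc_subset_Icc_left ht.1)).tendsto_nhdsGT_rightLim hA ht.2⟩,
    fun t ht => ?_⟩
  have h' := ((h.mono (Icc_subset_Icc_right ht.2)).reflect).tendsto_nhdsGT_rightLim
    (f := fun τ => f (-τ)) hA.reflect (neg_lt_neg ht.1)
  exact ⟨_, by simpa only [Function.comp_def, neg_neg] using h'.comp tendsto_neg_nhdsLT⟩

end IsPrimitiveOn

theorem IsControlledBy.hasIntegrableApprox (hA : IsControlledBy A v) (hab : a ≤ b) (hε : 0 ≤ ε)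
    {y : E} (hf : ∀ t ∈ Ioo a b, dist (f t) y ≤ ε) : HasIntegrableApprox A f ε a b := by
  obtain ⟨I, hI⟩ := hA.exists_integral_of_eqOn_Ioo (f := fun t => if t ∈ Ioo a b then y else f t)
    hab fun _ ht => if_pos ht
  refine ⟨_, fun t _ => ?_, if_neg (by simp), if_neg (by simp), I, hI⟩
  split_ifs with h
  · exact hf t h
  · simpa using hε

theorem IsRegulatedOn.hasIntegrableApprox (hf : IsRegulatedOn f a b) (hA : IsControlledBy A v)
    (hab : a ≤ b) (hε : 0 < ε) : HasIntegrableApprox A f ε a b := by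
  refine cousin_induction hab
    (fun t => hA.hasIntegrableApprox (y := 0) le_rfl hε.le (by simp))
    (fun r s t hrs hst h₁ h₂ => h₁.trans hrs hst h₂) (fun t ht => ?_) (fun t ht => ?_)
  · obtain ⟨L, hL⟩ := hf.1 t ht
    filter_upwards [self_mem_nhdsWithin, eventually_nhdsGT_forall_Ioc
      (hL (Metric.closedBall_mem_nhds L hε))] with s hts hs
    exact hA.hasIntegrableApprox (le_of_lt hts) hε.le fun q hq => hs q ⟨hq.1, hq.2.le⟩
  · obtain ⟨L, hL⟩ := hf.2 t ht
    filter_upwards [self_mem_nhdsWithin, eventually_nhdsLT_forall_Ico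
      (hL (Metric.closedBall_mem_nhds L hε))] with s hst hs
    exact hA.hasIntegrableApprox (le_of_lt hst) hε.le fun q hq => hs q ⟨hq.1.le, hq.2⟩

theorem IsRegulatedOn.exists_integral (hf : IsRegulatedOn f a b) (hA : IsControlledBy A v)
    (hab : a ≤ b) : ∃ I, HasKurzweilIntegralOn (fun τ t => A t (f τ)) a b I := by
  have happrox (n : ℕ) : HasIntegrableApprox A f (1 / ((n : ℝ) + 1)) a b :=
    hf.hasIntegrableApprox hA hab Nat.one_div_pos_of_nat
  choose g hg _ _ I hI using happrox
  have hlim : TendstoUniformlyOn g f atTop (Icc a b) := by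
    refine Metric.tendstoUniformlyOn_iff.2 fun ε hε => ?_
    filter_upwards [tendsto_one_div_add_atTop_nhds_zero_nat.eventually_lt_const hε] with n hn t ht
    exact (hg n t ht).trans_lt hn
  obtain ⟨J, -, hJ⟩ := hA.exists_integral_of_tendstoUniformlyOn hab hlim hI
  exact ⟨J, hJ⟩

theorem IsRegulatedOn.exists_isPrimitiveOn (hf : IsRegulatedOn f a b) (hA : IsControlledBy A v)
    (hc : c ∈ Icc a b) (y : F) :
    ∃ x, x c = y ∧ IsPrimitiveOn (fun τ t => A t (f τ)) (Icc a b) x := by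
  choose! I hI using fun t (ht : t ∈ Icc a b) => (hf.mono le_rfl ht.2).exists_integral hA ht.1
  refine ⟨fun t => y + (I t - I c), by simp, .of_left fun t ht => ?_⟩
  have hIa : I a = 0 := hasKurzweilIntegralOn_self.1 (hI a ⟨le_rfl, hc.1.trans hc.2⟩)
  simpa [hIa] using hI t ht

end RegulatedIntegral

section Solution

variable {E : Type*} [NormedAddCommGroup E] [NormedSpace ℝ E] {A : ℝ → E →L[ℝ] E} {v : ℝ → ℝ}
  {f g x y : ℝ → E} {J : Set ℝ} {a b c K : ℝ}

theorem hasKurzweilIntegral_iff_of_le {X : Type*} [NormedAddCommGroup X] {G : ℝ → ℝ → X} {I : X}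
    (hab : a ≤ b) : HasKurzweilIntegral G a b I ↔ HasKurzweilIntegralOn G a b I := by
  refine ⟨fun h => h.1 hab, fun h => ⟨fun _ => h, fun hba => ?_⟩⟩
  obtain rfl := hab.antisymm hba
  simpa only [hasKurzweilIntegralOn_self, neg_eq_zero] using h

theorem isSolution_iff : IsSolution A J x ↔ IsPrimitiveOn (fun τ t => A t (x τ)) J x :=
  forall₃_congr fun _ _ hcd => forall_congr' fun _ => hasKurzweilIntegral_iff_of_le hcd

namespace IsSolution

theorem mono {J' : Set ℝ} (h : IsSolution A J x) (hJ : J' ⊆ J) : IsSolution A J' x :=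
  isSolution_iff.2 ((isSolution_iff.1 h).mono hJ)

theorem congr {B : ℝ → E →L[ℝ] E} (h : IsSolution A J x) (hAB : EqOn A B J) (hxy : EqOn x y J) :
    IsSolution B J y :=
  isSolution_iff.2 <| (isSolution_iff.1 h).congr (fun _ hτ _ ht => by rw [hAB ht, hxy hτ]) hxy

theorem sub (hx : IsSolution A J x) (hy : IsSolution A J y) :
    IsSolution A J fun t => x t - y t := by
  simpa only [isSolution_iff, map_sub] using (isSolution_iff.1 hx).sub (isSolution_iff.1 hy)

theorem reflect (h : IsSolution A (Icc a b) x) :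
    IsSolution (fun t => A (-t)) (Icc (-b) (-a)) fun t => x (-t) :=
  isSolution_iff.2 (isSolution_iff.1 h).reflect

theorem exists_concat (hx : IsSolution A (Icc a b) x) (hy : IsSolution A (Icc b c) y)
    (h : x b = y b) (hab : a ≤ b) :
    ∃ z, IsSolution A (Icc a c) z ∧ EqOn z x (Iic b) ∧ EqOn z y (Ici b) := by
  obtain ⟨z, hzx, hzy⟩ := exists_eqOn_Iic_eqOn_Ici h
  have hx' := hx.congr (eqOn_refl A _) (hzx.symm.mono Icc_subset_Iic_self)
  have hy' := hy.congr (eqOn_refl A _) (hzy.symm.mono Icc_subset_Ici_self)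
  exact ⟨z, isSolution_iff.2 ((isSolution_iff.1 hx').concat (isSolution_iff.1 hy') hab), hzx, hzy⟩

end IsSolution

theorem isSolution_Icc_self (x : ℝ → E) : IsSolution A (Icc a a) x := by
  refine isSolution_iff.2 (.of_left fun t ht => ?_)
  obtain rfl : t = a := by simpa using ht
  exact hasKurzweilIntegralOn_self.2 (sub_self _)

theorem isSolution_zero : IsSolution A J 0 := by
  refine isSolution_iff.2 fun c d _ _ => ?_
  simpa using hasKurzweilIntegralOn_const (fun _ => (0 : E)) c d

theorem IsControlledBy.dist_le_of_isPrimitiveOn (hA : IsControlledBy A v)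
    (hx : IsPrimitiveOn (fun τ t => A t (f τ)) (Icc a b) x)
    (hy : IsPrimitiveOn (fun τ t => A t (g τ)) (Icc a b) y) (hc : c ∈ Icc a b) (h : x c = y c)
    (hv : v b - v a ≤ 1 / 2) (hK : ∀ t ∈ Icc a b, dist (f t) (g t) ≤ K) :
    ∀ t ∈ Icc a b, dist (x t) (y t) ≤ K / 2 := by
  intro t ht
  have hK₀ : 0 ≤ K := dist_nonneg.trans (hK t ht)
  have hD := hx.sub hy
  simp only [← map_sub] at hD
  have bound : ∀ p ∈ Icc a b, ∀ q ∈ Icc a b, p ≤ q →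
      ‖x q - y q - (x p - y p)‖ ≤ K * (1 / 2) := fun p hp q hq hpq =>
    calc _ ≤ K * (v q - v p) := hA.norm_integral_le hpq
          (fun τ hτ => dist_eq_norm (f τ) (g τ) ▸ hK τ ⟨hp.1.trans hτ.1, hτ.2.trans hq.2⟩)
          (hD p q hpq (Icc_subset_Icc hp.1 hq.2))
      _ ≤ K * (1 / 2) := by
        have := hA.monotone hp.1
        have := hA.monotone hq.2
        gcongr
        linarith
  rw [dist_eq_norm, div_eq_mul_one_div]
  rcases le_total c t with hct | htc
  · simpa [h] using bound c hc t ht hct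
  · simpa [h, norm_sub_rev] using bound t ht c hc htc

theorem exists_tendstoUniformlyOn_of_dist_le_half {α X : Type*} [PseudoMetricSpace X]
    [CompleteSpace X] {f : ℕ → α → X} {s : Set α}
    (h₀ : ∀ t ∈ s, dist (f 0 t) (f 1 t) ≤ K)
    (hf : ∀ n C, (∀ t ∈ s, dist (f n t) (f (n + 1) t) ≤ C) →
      ∀ t ∈ s, dist (f (n + 1) t) (f (n + 2) t) ≤ C / 2) :
    ∃ g, TendstoUniformlyOn f g atTop s := by
  have hstep : ∀ n, ∀ t ∈ s, dist (f n t) (f (n + 1) t) ≤ 2 * K / 2 / 2 ^ n := by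
    intro n
    induction n with
    | zero => simpa using h₀
    | succ n ih => exact fun t ht => (hf n _ ih t ht).trans_eq (by rw [pow_succ, div_div])
  have hlim : ∀ t ∈ s, ∃ z, Tendsto (fun n => f n t) atTop (𝓝 z) := fun t ht =>
    cauchySeq_tendsto_of_complete (cauchySeq_of_le_geometric_two fun n => hstep n t ht)
  rcases s.eq_empty_or_nonempty with rfl | ⟨t₀, _⟩
  · exact ⟨f 0, tendstoUniformlyOn_empty⟩
  have : Nonempty X := ⟨f 0 t₀⟩
  choose! g hg using hlim
  refine ⟨g, Metric.tendstoUniformlyOn_iff.2 fun ε hε => ?_⟩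
  have hgeom : Tendsto (fun n : ℕ => 2 * K / 2 ^ n) atTop (𝓝 0) :=
    tendsto_const_nhds.div_atTop (tendsto_pow_atTop_atTop_of_one_lt one_lt_two)
  filter_upwards [hgeom.eventually_lt_const hε] with n hn t ht
  rw [dist_comm]
  exact (dist_le_of_le_geometric_two_of_tendsto (fun n => hstep n t ht) (hg t ht) n).trans_lt hn

variable [CompleteSpace E]

theorem IsSolution.isRegulatedOn (h : IsSolution A (Icc a b) x) (hA : IsControlledBy A v) :
    IsRegulatedOn x a b :=
  (isSolution_iff.1 h).isRegulatedOn hA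

theorem IsSolution.eq_zero_of_le_half (h : IsSolution A (Icc a b) x) (hA : IsControlledBy A v)
    (hv : v b - v a ≤ 1 / 2) (hc : c ∈ Icc a b) (hxc : x c = 0) : ∀ t ∈ Icc a b, x t = 0 := by
  obtain ⟨m, hm⟩ := (h.isRegulatedOn hA).exists_norm_le (hc.1.trans hc.2)
  have hpow : ∀ n : ℕ, ∀ t ∈ Icc a b, dist (x t) ((0 : ℝ → E) t) ≤ m / 2 ^ n := by
    intro n
    induction n with
    | zero => simpa using hm
    | succ n ih =>
      rw [pow_succ, ← div_div]
      exact hA.dist_le_of_isPrimitiveOn (isSolution_iff.1 h) (isSolution_iff.1 isSolution_zero)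
        hc hxc hv ih
  intro t ht
  have hlim : Tendsto (fun n : ℕ => m / 2 ^ n) atTop (𝓝 0) :=
    tendsto_const_nhds.div_atTop (tendsto_pow_atTop_atTop_of_one_lt one_lt_two)
  exact dist_le_zero.1 (ge_of_tendsto' hlim fun n => hpow n t ht)

theorem IsControlledBy.exists_isSolution_of_le_half (hA : IsControlledBy A v)
    (hv : v b - v a ≤ 1 / 2) (hc : c ∈ Icc a b) (x₀ : E) :
    ∃ x, IsSolution A (Icc a b) x ∧ x c = x₀ := by
  have hab := hc.1.trans hc.2
  have picard (f : {f : ℝ → E // IsRegulatedOn f a b}) : ∃ g : {g : ℝ → E // IsRegulatedOn g a b},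
      g.1 c = x₀ ∧ IsPrimitiveOn (fun τ t => A t (f.1 τ)) (Icc a b) g.1 := by
    obtain ⟨g, hgc, hg⟩ := f.2.exists_isPrimitiveOn hA hc x₀
    exact ⟨⟨g, hg.isRegulatedOn hA⟩, hgc, hg⟩
  choose T hTc hT using picard
  let X (n : ℕ) : ℝ → E := (T^[n] ⟨_, .const x₀ a b⟩).1
  have hXr (n) : IsRegulatedOn (X n) a b := (T^[n] ⟨_, .const x₀ a b⟩).2
  have hXc (n) : X (n + 1) c = x₀ := by
    simpa only [X, Function.iterate_succ_apply'] using hTc _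
  have hX (n) : IsPrimitiveOn (fun τ t => A t (X n τ)) (Icc a b) (X (n + 1)) := by
    simpa only [X, Function.iterate_succ_apply'] using hT _
  obtain ⟨m, hm⟩ := ((hXr 0).sub (hXr 1)).exists_norm_le hab
  obtain ⟨x, hx⟩ := exists_tendstoUniformlyOn_of_dist_le_half
    (fun t ht => (dist_eq_norm _ _).trans_le (hm t ht)) fun n C hC =>
      hA.dist_le_of_isPrimitiveOn (hX n) (hX (n + 1)) hc ((hXc n).trans (hXc (n + 1)).symm) hv hC
  have hlim (t) (ht : t ∈ Icc a b) : Tendsto (fun n => X (n + 1) t) atTop (𝓝 (x t)) :=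
    (hx.tendsto_at ht).comp (tendsto_add_atTop_nat 1)
  refine ⟨x, isSolution_iff.2 fun p q hpq hpqs => ?_,
    tendsto_nhds_unique (hlim c hc) (by simp only [hXc, tendsto_const_nhds])⟩
  obtain ⟨J, hJlim, hJ⟩ := hA.exists_integral_of_tendstoUniformlyOn hpq (hx.mono hpqs)
    fun n => hX n p q hpq hpqs
  rwa [tendsto_nhds_unique hJlim ((hlim q (hpqs (right_mem_Icc.2 hpq))).sub
    (hlim p (hpqs (left_mem_Icc.2 hpq))))] at hJ

theorem isSolution_removeRightJump_iff (hA : IsControlledBy A v) (hxy : EqOn x y (Ioc a b))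
    (ha : y a = (1 + (Function.rightLim A a - A a)) (x a)) :
    IsSolution (removeRightJump A a) (Icc a b) y ↔ IsSolution A (Icc a b) x := by
  have hJ := hA.tendsto_apply_sub_nhdsGT a (x a)
  have hK : Tendsto (fun t => removeRightJump A a t (y a) - removeRightJump A a a (y a)) (𝓝[>] a)
      (𝓝 0) := by
    simpa [rightLim_eq_of_tendsto (hA.tendsto_removeRightJump a), removeRightJump_of_le] using
      (hA.removeRightJump a).tendsto_apply_sub_nhdsGT a (y a)
  have hAx : ∀ τ ∈ Ioc a b, ∀ t ∈ Ioc a b, A t (x τ) = removeRightJump A a t (y τ) :=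
    fun τ hτ t ht => by rw [hxy hτ, removeRightJump_of_lt ht.1]
  have ha' : x a + (Function.rightLim A a - A a) (x a) = y a + 0 := by simp [ha]
  rw [isSolution_iff, isSolution_iff]
  exact ⟨fun h => h.change_left (fun τ hτ t ht => (hAx τ hτ t ht).symm) hK hJ hxy.symm ha'.symm,
    fun h => h.change_left hAx hJ hK hxy ha'⟩

end Solution

section WellPosed

variable {E : Type*} [NormedAddCommGroup E] [NormedSpace ℝ E] {A : ℝ → E →L[ℝ] E} {v : ℝ → ℝ}
  {x y : ℝ → E} {J : Set ℝ} {a b c s : ℝ}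

/-- Initial value problems on `[a, b]` posed at either endpoint are solvable, and the values of a
solution at the two endpoints determine each other; by linearity it is enough to say so for the
value zero. -/
structure IsWellPosedOn (A : ℝ → E →L[ℝ] E) (a b : ℝ) : Prop where
  exists_left : ∀ x₀, ∃ x, IsSolution A (Icc a b) x ∧ x a = x₀
  exists_right : ∀ x₀, ∃ x, IsSolution A (Icc a b) x ∧ x b = x₀
  eq_zero_iff : ∀ x, IsSolution A (Icc a b) x → (x a = 0 ↔ x b = 0)

namespace IsWellPosedOn

theorem refl (A : ℝ → E →L[ℝ] E) (a : ℝ) : IsWellPosedOn A a a :=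
  ⟨fun x₀ => ⟨fun _ => x₀, isSolution_Icc_self _, rfl⟩,
    fun x₀ => ⟨fun _ => x₀, isSolution_Icc_self _, rfl⟩, fun _ _ => Iff.rfl⟩

theorem trans (hab : a ≤ b) (hbc : b ≤ c) (h₁ : IsWellPosedOn A a b) (h₂ : IsWellPosedOn A b c) :
    IsWellPosedOn A a c where
  exists_left x₀ := by
    obtain ⟨x, hx, hxa⟩ := h₁.exists_left x₀
    obtain ⟨y, hy, hyb⟩ := h₂.exists_left (x b)
    obtain ⟨z, hz, hzx, -⟩ := hx.exists_concat hy hyb.symm hab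
    exact ⟨z, hz, (hzx hab).trans hxa⟩
  exists_right x₀ := by
    obtain ⟨y, hy, hyc⟩ := h₂.exists_right x₀
    obtain ⟨x, hx, hxb⟩ := h₁.exists_right (y b)
    obtain ⟨z, hz, -, hzy⟩ := hx.exists_concat hy hxb hab
    exact ⟨z, hz, (hzy hbc).trans hyc⟩
  eq_zero_iff x hx := (h₁.eq_zero_iff x (hx.mono (Icc_subset_Icc_right hbc))).trans
    (h₂.eq_zero_iff x (hx.mono (Icc_subset_Icc_left hab)))

theorem of_reflect (h : IsWellPosedOn (fun t => A (-t)) (-b) (-a)) : IsWellPosedOn A a b where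
  exists_left x₀ := by
    obtain ⟨x, hx, hxa⟩ := h.exists_right x₀
    exact ⟨_, by simpa only [neg_neg] using hx.reflect, hxa⟩
  exists_right x₀ := by
    obtain ⟨x, hx, hxb⟩ := h.exists_left x₀
    exact ⟨_, by simpa only [neg_neg] using hx.reflect, hxb⟩
  eq_zero_iff x hx := by simpa only [neg_neg] using (h.eq_zero_iff _ hx.reflect).symm

variable [CompleteSpace E]

theorem of_le_half (hA : IsControlledBy A v) (hab : a ≤ b) (hv : v b - v a ≤ 1 / 2) :
    IsWellPosedOn A a b where
  exists_left := hA.exists_isSolution_of_le_half hv (left_mem_Icc.2 hab)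
  exists_right := hA.exists_isSolution_of_le_half hv (right_mem_Icc.2 hab)
  eq_zero_iff _ hx :=
    ⟨fun h => hx.eq_zero_of_le_half hA hv (left_mem_Icc.2 hab) h b (right_mem_Icc.2 hab),
      fun h => hx.eq_zero_of_le_half hA hv (right_mem_Icc.2 hab) h a (left_mem_Icc.2 hab)⟩

theorem of_removeRightJump (hA : IsControlledBy A v) (hab : a < b)
    (hunit : IsUnit (1 + (Function.rightLim A a - A a)))
    (h : IsWellPosedOn (removeRightJump A a) a b) : IsWellPosedOn A a b := by
  set B := 1 + (Function.rightLim A a - A a)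
  obtain ⟨hinj, hsurj⟩ : Function.Bijective B :=
    (Module.End.isUnit_iff _).1 (hunit.map ContinuousLinearMap.toLinearMapRingHom)
  have hupdate (x : ℝ → E) (z : E) : EqOn (Function.update x a z) x (Ioc a b) := fun t ht =>
    Function.update_of_ne ht.1.ne' z x
  refine ⟨fun x₀ => ?_, fun x₀ => ?_, fun x hx => ?_⟩
  · obtain ⟨y, hy, hya⟩ := h.exists_left (B x₀)
    refine ⟨Function.update y a x₀, (isSolution_removeRightJump_iff hA (hupdate y x₀) ?_).1 hy,
      Function.update_self _ _ _⟩
    rw [Function.update_self, hya]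
  · obtain ⟨y, hy, hyb⟩ := h.exists_right x₀
    obtain ⟨z, hz⟩ := hsurj (y a)
    refine ⟨Function.update y a z, (isSolution_removeRightJump_iff hA (hupdate y z) ?_).1 hy,
      (hupdate y z ⟨hab, le_rfl⟩).trans hyb⟩
    rw [Function.update_self, hz]
  · have hy := (isSolution_removeRightJump_iff hA (hupdate x (B (x a))).symm
      (Function.update_self _ _ _)).2 hx
    have hzero := h.eq_zero_iff _ hy
    rwa [Function.update_self, hupdate x _ ⟨hab, le_rfl⟩, map_eq_zero_iff _ hinj] at hzero

end IsWellPosedOn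

/-- The coefficients on the whole line for which initial value problems are uniquely solvable in
both directions: those of locally bounded variation (as witnessed by `v`) whose jumps satisfy
condition (D) at every point. -/
structure IsRegular (A : ℝ → E →L[ℝ] E) (v : ℝ → ℝ) : Prop where
  isControlledBy : IsControlledBy A v
  isUnit_left : ∀ t, IsUnit (1 - (A t - Function.leftLim A t))
  isUnit_right : ∀ t, IsUnit (1 + (Function.rightLim A t - A t))

namespace IsRegular

variable [CompleteSpace E]

theorem reflect (h : IsRegular A v) : IsRegular (fun t => A (-t)) (fun t => -v (-t)) where
  isControlledBy := h.isControlledBy.reflect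
  isUnit_left t := by
    have hlim : Function.leftLim (fun s => A (-s)) t = Function.rightLim A (-t) :=
      leftLim_eq_of_tendsto ((h.isControlledBy.tendsto_rightLim (-t)).comp tendsto_neg_nhdsLT)
    rw [hlim, ← neg_sub (Function.rightLim A (-t)), sub_neg_eq_add]
    exact h.isUnit_right (-t)
  isUnit_right t := by
    have hlim : Function.rightLim (fun s => A (-s)) t = Function.leftLim A (-t) :=
      rightLim_eq_of_tendsto ((h.isControlledBy.tendsto_leftLim (-t)).comp tendsto_neg_nhdsGT)
    rw [hlim, ← neg_sub (A (-t)), ← sub_eq_add_neg]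
    exact h.isUnit_left (-t)

theorem eventually_isWellPosedOn_nhdsGT (h : IsRegular A v) (t : ℝ) :
    ∀ᶠ s in 𝓝[>] t, IsWellPosedOn A t s := by
  have hv := (h.isControlledBy.monotone.tendsto_rightLim t).eventually_le_const
    (lt_add_of_pos_right _ (one_half_pos (α := ℝ)))
  filter_upwards [self_mem_nhdsWithin, hv] with s (hts : t < s) hs
  refine .of_removeRightJump h.isControlledBy hts (h.isUnit_right t)
    (.of_le_half (h.isControlledBy.removeRightJump t) hts.le ?_)
  rw [removeRightJump_of_lt hts, removeRightJump_of_le le_rfl]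
  linarith

theorem isWellPosedOn (h : IsRegular A v) (hab : a ≤ b) : IsWellPosedOn A a b := by
  refine cousin_induction hab (.refl A) (fun _ _ _ hrs hst h₁ h₂ => h₁.trans hrs hst h₂)
    (fun t _ => h.eventually_isWellPosedOn_nhdsGT t) fun t _ => ?_
  filter_upwards [tendsto_neg_nhdsLT.eventually
    (h.reflect.eventually_isWellPosedOn_nhdsGT (-t))] with s hs
  exact hs.of_reflect

theorem eqOn_zero [J.OrdConnected] (h : IsRegular A v) (hx : IsSolution A J x) (hs : s ∈ J)
    (hxs : x s = 0) : EqOn x 0 J := by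
  intro t ht
  rcases le_total s t with hst | hts
  · exact ((h.isWellPosedOn hst).eq_zero_iff x (hx.mono (Set.Icc_subset J hs ht))).1 hxs
  · exact ((h.isWellPosedOn hts).eq_zero_iff x (hx.mono (Set.Icc_subset J ht hs))).2 hxs

theorem eqOn_of_eq [J.OrdConnected] (h : IsRegular A v) (hx : IsSolution A J x)
    (hy : IsSolution A J y) (hs : s ∈ J) (hxy : x s = y s) : EqOn x y J := fun _ ht =>
  sub_eq_zero.1 (h.eqOn_zero (hx.sub hy) hs (sub_eq_zero.2 hxy) ht)

theorem exists_isSolution_Icc (h : IsRegular A v) (hs : s ∈ Icc a b) (x₀ : E) :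
    ∃ x, IsSolution A (Icc a b) x ∧ x s = x₀ := by
  obtain ⟨x, hx, hxs⟩ := (h.isWellPosedOn hs.1).exists_right x₀
  obtain ⟨y, hy, hys⟩ := (h.isWellPosedOn hs.2).exists_left x₀
  obtain ⟨z, hz, hzx, -⟩ := hx.exists_concat hy (hxs.trans hys.symm) hs.1
  exact ⟨z, hz, (hzx self_mem_Iic).trans hxs⟩

theorem exists_isSolution_univ (h : IsRegular A v) (s : ℝ) (x₀ : E) :
    ∃ x, IsSolution A univ x ∧ x s = x₀ := by
  have hex (r : ℝ) (hr : 0 ≤ r) : ∃ x, IsSolution A (Metric.closedBall s r) x ∧ x s = x₀ := by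
    rw [Real.closedBall_eq_Icc]
    exact h.exists_isSolution_Icc ⟨sub_le_self s hr, le_add_of_nonneg_right hr⟩ x₀
  choose! X hX hXs using hex
  have hord (r : ℝ) : (Metric.closedBall s r).OrdConnected := (convex_closedBall s r).ordConnected
  have hXeq (r : ℝ) (hr : 0 ≤ r) : EqOn (X r) (fun t => X (dist t s) t) (Metric.closedBall s r) :=
    fun t ht => h.eqOn_of_eq ((hX r hr).mono (Metric.closedBall_subset_closedBall ht))
      (hX _ dist_nonneg) (Metric.mem_closedBall_self dist_nonneg)
      ((hXs r hr).trans (hXs _ dist_nonneg).symm) (Metric.mem_closedBall.2 le_rfl)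
  refine ⟨fun t => X (dist t s) t, fun c d hcd _ => ?_, hXs _ dist_nonneg⟩
  have hr : 0 ≤ max (dist c s) (dist d s) := le_max_of_le_left dist_nonneg
  exact (hX _ hr).congr (eqOn_refl A _) (hXeq _ hr) c d hcd
    (Set.Icc_subset _ (Metric.mem_closedBall.2 (le_max_left _ _))
      (Metric.mem_closedBall.2 (le_max_right _ _)))

theorem mul_left (h : IsRegular A v) :
    IsRegular (fun t => ContinuousLinearMap.mul ℝ (E →L[ℝ] E) (A t)) v := by
  set M := ContinuousLinearMap.mul ℝ (E →L[ℝ] E) with hM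
  have hone : M 1 = 1 := by
    ext1 C
    simp [hM]
  have hunit (B : E →L[ℝ] E) (hB : IsUnit B) : IsUnit (M B) := by
    obtain ⟨u, rfl⟩ := hB
    refine ⟨⟨M u, M ↑u⁻¹, ?_, ?_⟩, rfl⟩ <;> ext1 C <;> simp [hM, ← mul_assoc]
  refine ⟨fun s t hst => ?_, fun t => ?_, fun t => ?_⟩
  · rw [← map_sub]
    exact (ContinuousLinearMap.opNorm_mul_apply_le _ _ _).trans (h.isControlledBy s t hst)
  · have hlim : Function.leftLim (fun s => M (A s)) t = M (Function.leftLim A t) :=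
      leftLim_eq_of_tendsto ((M.continuous.tendsto _).comp (h.isControlledBy.tendsto_leftLim t))
    rw [hlim, ← hone, ← map_sub, ← map_sub]
    exact hunit _ (h.isUnit_left t)
  · have hlim : Function.rightLim (fun s => M (A s)) t = M (Function.rightLim A t) :=
      rightLim_eq_of_tendsto ((M.continuous.tendsto _).comp (h.isControlledBy.tendsto_rightLim t))
    rw [hlim, ← hone, ← map_sub, ← map_add]
    exact hunit _ (h.isUnit_right t)

end IsRegular

end WellPosed

section HalfLine

variable {E : Type*} [NormedAddCommGroup E] [NormedSpace ℝ E] {A : ℝ → E →L[ℝ] E}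
  {U : ℝ → ℝ → E →L[ℝ] E} {x y : ℝ → E} {s t : ℝ}

theorem isControlledBy_of_locallyBoundedVariationOn {X : Type*} [NormedAddCommGroup X] {A : ℝ → X}
    (hA : LocallyBoundedVariationOn A (Ici 0)) :
    IsControlledBy (fun t => A (max t 0)) fun t =>
      variationOnFromTo A (Ici 0) 0 (max t 0) := by
  intro s t hst
  have hmem (r : ℝ) : max r 0 ∈ Ici (0 : ℝ) := le_max_right r 0
  have hmax : max s 0 ≤ max t 0 := max_le_max_right 0 hst
  rw [variationOnFromTo.sub_right hA self_mem_Ici (hmem t) (hmem s),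
    variationOnFromTo.eq_of_le _ _ hmax, ← dist_eq_norm, dist_edist]
  exact ENNReal.toReal_mono (hA _ _ (hmem s) (hmem t))
    (eVariationOn.edist_le A ⟨hmem t, hmax, le_rfl⟩ ⟨hmem s, le_rfl, hmax⟩)

theorem IsTransitionMatrix.apply_self (hU : IsTransitionMatrix A U) (hs : 0 ≤ s) : U s s = 1 :=
  sub_eq_zero.1 (hasKurzweilIntegralOn_self.1 ((hU s hs s hs).1 le_rfl))

theorem IsTransitionMatrix.isSolution (hU : IsTransitionMatrix A U) (hs : 0 ≤ s) (x₀ : E) :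
    IsSolution A (Ici s) fun t => U t s x₀ := by
  refine isSolution_iff.2 fun c d hcd hJ => ?_
  have hd : IsPrimitiveOn (fun τ r => A r (U τ s x₀)) (Icc s d) fun t => U t s x₀ := by
    refine .of_left fun t ht => ?_
    simpa [hU.apply_self hs] using
      ((hU t (hs.trans ht.1) s hs).1 ht.1).map (ContinuousLinearMap.apply ℝ E x₀)
        (ContinuousLinearMap.apply ℝ E x₀).continuous
  exact hd c d hcd (Icc_subset_Icc_left (hJ (left_mem_Icc.2 hcd)))

variable [CompleteSpace E]

theorem ConditionD.isRegular (hD : ConditionD A) (hA : LocallyBoundedVariationOn A (Ici 0)) :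
    IsRegular (fun t => A (max t 0)) fun t => variationOnFromTo A (Ici 0) 0 (max t 0) where
  isControlledBy := isControlledBy_of_locallyBoundedVariationOn hA
  isUnit_left t := by
    have hA' := isControlledBy_of_locallyBoundedVariationOn hA
    rcases le_or_gt t 0 with ht | ht
    · have hlim : Function.leftLim (fun s => A (max s 0)) t = A 0 :=
        leftLim_eq_of_tendsto <| tendsto_const_nhds.congr' <|
          eventually_mem_nhdsWithin.mono fun s (hs : s < t) => by
            simp only [max_eq_right (hs.le.trans ht)]
      simp [hlim, max_eq_right ht]
    · have hlim : Function.leftLim A t = Function.leftLim (fun s => A (max s 0)) t :=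
        leftLim_eq_of_tendsto <| (hA'.tendsto_leftLim t).congr' <| by
          filter_upwards [Ioo_mem_nhdsLT ht] with s hs
          rw [max_eq_left hs.1.le]
      rw [max_eq_left ht.le, ← hlim]
      exact hD.1 t ht
  isUnit_right t := by
    have hA' := isControlledBy_of_locallyBoundedVariationOn hA
    rcases lt_or_ge t 0 with ht | ht
    · have hlim : Function.rightLim (fun s => A (max s 0)) t = A 0 :=
        rightLim_eq_of_tendsto <| tendsto_const_nhds.congr' <| by
          filter_upwards [Ioo_mem_nhdsGT ht] with s hs
          rw [max_eq_right hs.2.le]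
      simp [hlim, max_eq_right ht.le]
    · have hlim : Function.rightLim A t = Function.rightLim (fun s => A (max s 0)) t :=
        rightLim_eq_of_tendsto <| (hA'.tendsto_rightLim t).congr' <|
          eventually_mem_nhdsWithin.mono fun s (hs : t < s) => by rw [max_eq_left (ht.trans hs.le)]
      rw [max_eq_left ht, ← hlim]
      exact hD.2 t ht

theorem isTransitionMatrix_transitionMatrix (hA : LocallyBoundedVariationOn A (Ici 0))
    (hD : ConditionD A) : IsTransitionMatrix A (transitionMatrix A) := by
  refine Classical.epsilon_spec (p := IsTransitionMatrix A) ?_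
  choose X hX hXs using fun s =>
    (hD.isRegular hA).mul_left.exists_isSolution_univ s (1 : E →L[ℝ] E)
  have hint (s a b : ℝ) (ha : 0 ≤ a) (hab : a ≤ b) :
      HasKurzweilIntegralOn (fun τ r => A r * X s τ) a b (X s b - X s a) :=
    (isSolution_iff.1 (hX s) a b hab (subset_univ _)).congr fun τ _ r hr => by
      simp [max_eq_left (ha.trans hr.1)]
  refine ⟨fun t s => X s t, fun t ht s hs => ⟨fun hst => ?_, fun hts => ?_⟩⟩
  · simpa [hXs] using hint s s t hs hst
  · simpa [hXs] using hint s t s ht hts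

theorem IsSolution.eq_of_eq (hA : LocallyBoundedVariationOn A (Ici 0)) (hD : ConditionD A)
    (hs : 0 ≤ s) (hx : IsSolution A (Ici s) x) (hy : IsSolution A (Ici s) y) (hxy : x s = y s) :
    EqOn x y (Ici s) := by
  have hAmax : EqOn A (fun t => A (max t 0)) (Ici s) := fun t ht => by
    simp only [max_eq_left (hs.trans ht)]
  exact (hD.isRegular hA).eqOn_of_eq (hx.congr hAmax (eqOn_refl x _))
    (hy.congr hAmax (eqOn_refl y _)) self_mem_Ici hxy

theorem isStable_iff_equicontinuousAt (hA : LocallyBoundedVariationOn A (Ici 0))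
    (hD : ConditionD A) : IsStable A ↔
      ∀ s ≥ 0, EquicontinuousAt (fun (t : Ici s) x => transitionMatrix A t s x) 0 := by
  have hU := isTransitionMatrix_transitionMatrix hA hD
  refine forall₂_congr fun s hs => ?_
  simp only [Metric.equicontinuousAt_iff, map_zero, dist_zero_left, dist_zero_right]
  refine forall₂_congr fun ε _ => exists_congr fun δ => and_congr_right fun _ =>
    forall₂_congr fun x₀ _ => ⟨fun h t => ?_, fun h x hx hxs t ht => ?_⟩
  · exact h _ (hU.isSolution hs x₀) (by simp [hU.apply_self hs]) t t.2
  · rw [hx.eq_of_eq hA hD hs (hU.isSolution hs x₀) (by simp [hU.apply_self hs, hxs]) ht]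
    exact h ⟨t, ht⟩

end HalfLine

end GLDE

theorem corollary3p2_general {E : Type*} [NormedAddCommGroup E] [NormedSpace ℝ E]
    [CompleteSpace E] (A : ℝ → E →L[ℝ] E)
    (hA : LocallyBoundedVariationOn A (Set.Ici 0)) (hD : GLDE.ConditionD A) :
    GLDE.IsStable A ↔
      ∀ s₀ : ℝ, 0 ≤ s₀ → ∃ C : ℝ, 0 < C ∧
        ∀ t : ℝ, s₀ ≤ t → ‖GLDE.transitionMatrix A t s₀‖ ≤ C := by
  rw [GLDE.isStable_iff_equicontinuousAt hA hD]
  refine forall₂_congr fun s _ => ?_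
  have htfae := (NormedSpace.equicontinuous_TFAE
    fun t : Set.Ici s => GLDE.transitionMatrix A t s).out 0 5
  refine htfae.trans ⟨fun ⟨C, hC⟩ => ?_, fun ⟨C, _, hC⟩ => ⟨C, fun t => hC t t.2⟩⟩
  exact ⟨max C 1, by positivity, fun t ht => (hC ⟨t, ht⟩).trans (le_max_left _ _)⟩

theorem corollary3p2 {E : Type*} [NormedAddCommGroup E] [NormedSpace ℝ E]
    [FiniteDimensional ℝ E] (A : ℝ → E →L[ℝ] E)
    (hA : LocallyBoundedVariationOn A (Set.Ici 0)) (hD : GLDE.ConditionD A) :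
    GLDE.IsStable A ↔
      ∀ s₀ : ℝ, 0 ≤ s₀ → ∃ C : ℝ, 0 < C ∧
        ∀ t : ℝ, s₀ ≤ t → ‖GLDE.transitionMatrix A t s₀‖ ≤ C := by
  have := FiniteDimensional.complete ℝ E
  exact corollary3p2_general A hA hD
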